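/- A QUBO Hamiltonian is a polynomial $H(x_1,\dots,x_n)=\sum_{i=1}^n w_i x_i+\sum_{i=1}^n\sum_{j=i+1}^n w_{ij}x_ix_j$ with integer weights; a ground state of $H$ is a vector $x\in\{0,1\}^n$ that minimizes $H$. The terms of $H$ are the $w_ix_i$ with $w_i\neq 0$ and the $w_{ij}x_ix_j$ with $w_{ij}\neq 0$; $|H|$ is the number of variables plus the number of terms. The primal graph of $H$ has the vertices $x_1,\dots,x_n$ and connects two variables that appear together in a term, and $\mathrm{tw}(H)$ is the treewidth of this graph (taken to be $0$ if $n=0$). **Corollary (QUBO Upper Bound).** Given a QUBO Hamiltonian $H$ and a tree decomposition of its primal graph of optimal width, a ground state of $H$ can be computed in time $O\big(2^{\mathrm{tw}(H)}|H|\big)$. Precisely: there are a single random access machine program and a constant $C$ such that for every Hamiltonian $H$ and every tree decomposition of the primal graph of $H$, with $m$ nodes and width $k$ (the largest bag size minus one, or $0$ if $n=0$), the program, started on a listing of the terms of $H$ with their weights (in any order) and of the tree decomposition (rooted, every node listed after its parent with its parent and its bag), halts with a ground state of $H$ in its memory after at most $C\cdot 2^{k}\,(|H|+m)$ steps; in particular,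 if $k=\mathrm{tw}(H)$ and $m\le|H|$, after at most $C\cdot 2^{\mathrm{tw}(H)}|H|$ steps. The machine has integer registers and integer memory cells with indirect addressing, and each addition, subtraction, assignment of a constant, memory access and test for positivity takes one step; there is no multiplication, division or bit operation. -/

import Mathlib

/-! ### Hamiltonians -/

/-- A QUBO Hamiltonian `H(x_1,…,x_n) = ∑ i, w_i x_i + ∑ i, ∑ j > i, w_ij x_i x_j` with integer
weights: `lin i` is `w_i` and `quad i j`, for `i < j`, is `w_ij` (the entries of `quad` on and
below the diagonal are never used). -/
structure Hamiltonian where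
  n : ℕ
  lin : Fin n → ℤ
  quad : Fin n → Fin n → ℤ

namespace Hamiltonian

/-- The value `H(x)` at a vector `x ∈ {0,1}ⁿ`. -/
def energy (H : Hamiltonian) (x : Fin H.n → Fin 2) : ℤ :=
  ∑ i, H.lin i * ((x i : ℕ) : ℤ)
    + ∑ i, ∑ j ∈ Finset.Ioi i, H.quad i j * ((x i : ℕ) : ℤ) * ((x j : ℕ) : ℤ)

/-- `x` is a ground state: a vector in `{0,1}ⁿ` that minimizes `H`. -/
def IsGroundState (H : Hamiltonian) (x : Fin H.n → Fin 2) : Prop :=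
  ∀ y : Fin H.n → Fin 2, H.energy x ≤ H.energy y

/-- The weight of the term with variables `i ≤ j`: linear if `i = j`, quadratic if `i < j`. -/
def weight (H : Hamiltonian) (i j : Fin H.n) : ℤ :=
  if i = j then H.lin i else H.quad i j

/-- The terms of `H`: the pair `(i, i)` stands for the variable set `{x_i}` of a term
`w_i x_i` with `w_i ≠ 0`, and `(i, j)` with `i < j` for the variable set `{x_i, x_j}` of a term
`w_ij x_i x_j` with `w_ij ≠ 0`. -/
def terms (H : Hamiltonian) : Finset (Fin H.n × Fin H.n) :=
  Finset.univ.filter fun p => p.1 ≤ p.2 ∧ H.weight p.1 p.2 ≠ 0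

/-- The size `|H|`: the number of variables plus the number of (nonzero) terms. -/
def size (H : Hamiltonian) : ℕ := H.n + H.terms.card

/-- The primal graph: its vertices are the variables, and two distinct variables are adjacent
if they appear together in a term. -/
def primalGraph (H : Hamiltonian) : SimpleGraph (Fin H.n) :=
  SimpleGraph.fromRel fun i j => (i, j) ∈ H.terms

end Hamiltonian

/-! ### Treewidth -/

/-- A tree decomposition of `G`, with nodes `0, …, m - 1`. -/
structure TreeDecomposition {V : Type*} (G : SimpleGraph V) where
  m : ℕ
  tree : SimpleGraph (Fin m)
  isTree : tree.IsTree
  bag : Fin m → Finset V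
  /-- for every vertex the nodes whose bags contain it induce a nonempty subtree -/
  connected : ∀ v, (tree.induce {t | v ∈ bag t}).Connected
  /-- every edge is contained in a bag -/
  covering : ∀ u v, G.Adj u v → ∃ t, u ∈ bag t ∧ v ∈ bag t

/-- The width: the largest size of a bag, minus one (`0` if all bags are empty, which happens
only for a graph without vertices). -/
def TreeDecomposition.width {V : Type*} {G : SimpleGraph V} (D : TreeDecomposition G) : ℕ :=
  (Finset.univ.sup fun t => (D.bag t).card) - 1

/-- The treewidth: the least width of a tree decomposition. -/
noncomputable def treewidth {V : Type*} [Finite V] (G : SimpleGraph V) : ℕ :=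
  sInf (Set.range fun D : TreeDecomposition G => D.width)

/-- The treewidth `tw(H)` of a Hamiltonian is the treewidth of its primal graph. -/
noncomputable def Hamiltonian.tw (H : Hamiltonian) : ℕ := treewidth H.primalGraph

/-! ### Random access machines

A random access machine with integer registers `r_0, r_1, …` (a program mentions only finitely
many of them), a memory whose cells hold integers and are indexed by integers, addition,
subtraction, indirect addressing and tests for positivity. There is no multiplication, division
or bit operation. Every elementary instruction and every test takes one step. -/

namespace RAM

/-- A state of the machine: the contents of the registers and of the memory. -/
structure State where
  reg : ℕ → ℤ
  mem : ℤ → ℤ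

/-- Programs. -/
inductive Program where
  /-- do nothing -/
  | skip : Program
  /-- `r_d := c` -/
  | const (d : ℕ) (c : ℤ) : Program
  /-- `r_d := r_a + r_b` -/
  | add (d a b : ℕ) : Program
  /-- `r_d := r_a - r_b` -/
  | sub (d a b : ℕ) : Program
  /-- `r_d := mem[r_a]` -/
  | load (d a : ℕ) : Program
  /-- `mem[r_a] := r_b` -/
  | store (a b : ℕ) : Program
  /-- first `p`, then `q` -/
  | seq (p q : Program) : Program
  /-- if `r_a > 0` then `p` else `q` -/
  | ifPos (a : ℕ) (p q : Program) : Program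
  /-- while `r_a > 0` do `p` -/
  | whilePos (a : ℕ) (p : Program) : Program

/-- Write the value `v` to the register `r_d`. -/
def State.setReg (s : State) (d : ℕ) (v : ℤ) : State :=
  { s with reg := Function.update s.reg d v }

/-- Write the value `v` to the memory cell with address `a`. -/
def State.setMem (s : State) (a v : ℤ) : State :=
  { s with mem := Function.update s.mem a v }

/-- `Runs p s s' t`: started in state `s`, the program `p` halts in state `s'` after exactly `t`
steps. -/
inductive Runs : Program → State → State → ℕ → Prop
  | skip (s : State) : Runs .skip s s 1
  | const (s : State) (d : ℕ) (c : ℤ) : Runs (.const d c) s (s.setReg d c) 1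
  | add (s : State) (d a b : ℕ) : Runs (.add d a b) s (s.setReg d (s.reg a + s.reg b)) 1
  | sub (s : State) (d a b : ℕ) : Runs (.sub d a b) s (s.setReg d (s.reg a - s.reg b)) 1
  | load (s : State) (d a : ℕ) : Runs (.load d a) s (s.setReg d (s.mem (s.reg a))) 1
  | store (s : State) (a b : ℕ) : Runs (.store a b) s (s.setMem (s.reg a) (s.reg b)) 1
  | seq {p q : Program} {s s₁ s₂ : State} {t₁ t₂ : ℕ}
      (h₁ : Runs p s s₁ t₁) (h₂ : Runs q s₁ s₂ t₂) : Runs (.seq p q) s s₂ (t₁ + t₂)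
  | ifTrue {a : ℕ} {p q : Program} {s s' : State} {t : ℕ}
      (h : 0 < s.reg a) (hp : Runs p s s' t) : Runs (.ifPos a p q) s s' (t + 1)
  | ifFalse {a : ℕ} {p q : Program} {s s' : State} {t : ℕ}
      (h : ¬ 0 < s.reg a) (hq : Runs q s s' t) : Runs (.ifPos a p q) s s' (t + 1)
  | whileTrue {a : ℕ} {p : Program} {s s₁ s₂ : State} {t₁ t₂ : ℕ}
      (h : 0 < s.reg a) (hp : Runs p s s₁ t₁) (hw : Runs (.whilePos a p) s₁ s₂ t₂) :
      Runs (.whilePos a p) s s₂ (t₁ + t₂ + 1)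
  | whileFalse {a : ℕ} {p : Program} {s : State}
      (h : ¬ 0 < s.reg a) : Runs (.whilePos a p) s s 1

/-- The initial state on the input `l`: the entries of `l` are in the memory cells
`0, …, l.length - 1`; all other cells and all registers are zero. -/
def initial (l : List ℤ) : State where
  reg := fun _ => 0
  mem := fun a => if 0 ≤ a then l.getD a.toNat 0 else 0

end RAM

/-! ### The input -/

/-- A presentation of a Hamiltonian `H` and a tree decomposition `D` of its primal graph as a
machine input: the terms of `H` in any order, the tree rooted at node `0` with every node
numbered after its parent, and the elements of every bag in any order. -/
structure Presentation (H : Hamiltonian) (D : TreeDecomposition H.primalGraph) where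
  terms : List (Fin H.n × Fin H.n)
  terms_nodup : terms.Nodup
  mem_terms : ∀ p, p ∈ terms ↔ p ∈ H.terms
  parent : Fin D.m → Fin D.m
  parent_root : ∀ t : Fin D.m, t.val = 0 → parent t = t
  parent_lt : ∀ t : Fin D.m, 0 < t.val → parent t < t
  parent_adj : ∀ t : Fin D.m, 0 < t.val → D.tree.Adj (parent t) t
  bags : Fin D.m → List (Fin H.n)
  bags_nodup : ∀ t, (bags t).Nodup
  mem_bags : ∀ t v, v ∈ bags t ↔ v ∈ D.bag t

/-- The input as a list of integers: the number of variables; the number of terms; for each term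
its two indices and its weight; the number of nodes of the tree; for each node its parent, the
size of its bag and the elements of its bag. -/
def Presentation.encode {H : Hamiltonian} {D : TreeDecomposition H.primalGraph}
    (I : Presentation H D) : List ℤ :=
  [(H.n : ℤ), (I.terms.length : ℤ)]
    ++ I.terms.flatMap (fun p => [((p.1 : ℕ) : ℤ), ((p.2 : ℕ) : ℤ), H.weight p.1 p.2])
    ++ [(D.m : ℤ)]
    ++ (List.finRange D.m).flatMap (fun t =>
        [((I.parent t : ℕ) : ℤ), ((I.bags t).length : ℤ)]
          ++ (I.bags t).map (fun v => ((v : ℕ) : ℤ)))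

/-!
Put every term into the table of the topmost node whose bag contains both of its variables, and
eliminate the nodes of the rooted tree from the leaves to the root. Eliminating a node `t` replaces
its table by the optimal values over all extensions of an assignment to the separator of `t` from
its parent; these values move to the table of the parent. So the Hamiltonian remains, up to a
constant, the sum of the tables of the remaining nodes and of nonnegative losses at the eliminated
ones, and going from the root to the leaves one can choose an assignment at which all losses vanish.

An assignment to a bag is encoded by the binary number whose digits are its values. To spend only
`O(2 ^ |bag|)` steps per node and per term without bit operations, put marks on some variables and
compute the sums of the marks of all subsets of the bag, each from that of the subset without its
last element. With unit marks on the variables of a term, the sums tell where the term is `1`; with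
powers of two on the separator, they give the indices of the restrictions to the separator.
-/

namespace QUBO

/-! ### A language with `for` loops -/

/-- The variables of the program; each holds a natural number. -/
inductive Var where
  | q | t | r | i | j | a | node | pos | cells | key | best
  deriving DecidableEq

/-- The arrays of the program; each holds integers. The array `input` is the input of the machine
and finally receives the output. -/
inductive Arr where
  | input | pow | start | offset | top | mark | sum | table | choice | sol
  deriving DecidableEq

/-- The values of the variables and of the array entries. -/
structure Store where
  var : Var → ℕ
  arr : Arr → ℕ → ℤ

namespace Store

/-- Assignment to a variable. -/
def setVar (s : Store) (x : Var) (k : ℕ) : Store :=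
  { s with var := Function.update s.var x k }

/-- Assignment to an array entry. -/
def setArr (s : Store) (A : Arr) (i : ℕ) (k : ℤ) : Store :=
  { s with arr := Function.update s.arr A (Function.update (s.arr A) i k) }

@[simp] theorem setVar_var_self (s : Store) (x : Var) (k : ℕ) : (s.setVar x k).var x = k := by
  simp [setVar]

@[simp] theorem setVar_var_of_ne (s : Store) {x y : Var} (h : y ≠ x) (k : ℕ) :
    (s.setVar x k).var y = s.var y := by
  simp [setVar, h]

@[simp] theorem setVar_arr (s : Store) (x : Var) (k : ℕ) : (s.setVar x k).arr = s.arr := rfl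

@[simp] theorem setArr_var (s : Store) (A : Arr) (i : ℕ) (k : ℤ) :
    (s.setArr A i k).var = s.var := rfl

@[simp] theorem setArr_arr_self (s : Store) (A : Arr) (i : ℕ) (k : ℤ) :
    (s.setArr A i k).arr A = Function.update (s.arr A) i k := by
  simp [setArr]

@[simp] theorem setArr_arr_of_ne (s : Store) {A B : Arr} (h : B ≠ A) (i : ℕ) (k : ℤ) :
    (s.setArr A i k).arr B = s.arr B := by
  simp [setArr, h]

end Store

/-- Integer expressions over the variables and the array entries. -/
inductive Exp where
  | lit (k : ℕ)
  | var (x : Var)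
  | get (A : Arr) (e : Exp)
  | add (e f : Exp)
  | sub (e f : Exp)

namespace Exp

instance (k : ℕ) : OfNat Exp k := ⟨lit k⟩
instance : Add Exp := ⟨add⟩
instance : Sub Exp := ⟨sub⟩

/-- The value of an expression. A negative array index is replaced by `0`. -/
def eval (s : Store) : Exp → ℤ
  | lit k => k
  | var x => s.var x
  | get A e => s.arr A (e.eval s).toNat
  | add e f => e.eval s + f.eval s
  | sub e f => e.eval s - f.eval s

variable (s : Store)

@[simp] theorem eval_ofNat (k : ℕ) : eval s (no_index (OfNat.ofNat k)) = k := rfl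

@[simp] theorem eval_var (x : Var) : eval s (var x) = s.var x := rfl

@[simp] theorem eval_get (A : Arr) (e : Exp) : eval s (get A e) = s.arr A (e.eval s).toNat := rfl

@[simp] theorem eval_add (e f : Exp) : eval s (e + f) = e.eval s + f.eval s := rfl

@[simp] theorem eval_sub (e f : Exp) : eval s (e - f) = e.eval s - f.eval s := rfl

end Exp

/-- Commands of the language. In `set` and `put`, a negative value assigned to a variable and a
negative index are replaced by `0`; `loop x e p` executes `p` for `x = 0, …, e - 1`, where `e` is
evaluated once. -/
inductive Cmd where
  | skip
  | set (x : Var) (e : Exp)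
  | put (A : Arr) (e f : Exp)
  | seq (p q : Cmd)
  | ifLt (e f : Exp) (p q : Cmd)
  | loop (x : Var) (e : Exp) (p : Cmd)

infixr:60 " ;; " => Cmd.seq

/-- The store after `k` rounds of a loop with body `f` and loop variable `x`. -/
def iterate (f : Store → Store) (x : Var) (s : Store) : ℕ → Store
  | 0 => s
  | k + 1 => f ((iterate f x s k).setVar x k)

namespace Cmd

/-- The store after the execution of a command. -/
def run : Cmd → Store → Store
  | skip, s => s
  | set x e, s => s.setVar x (e.eval s).toNat
  | put A e f, s => s.setArr A (e.eval s).toNat (f.eval s)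
  | seq p q, s => q.run (p.run s)
  | ifLt e f p q, s => if e.eval s < f.eval s then p.run s else q.run s
  | loop x e p, s => iterate p.run x s (e.eval s).toNat

/-- The cost of the execution of a command: the number of assignments, tests, `skip`s, loops and
rounds of loops. -/
def cost : Cmd → Store → ℕ
  | skip, _ => 1
  | set _ _, _ => 1
  | put _ _ _, _ => 1
  | seq p q, s => p.cost s + q.cost (p.run s)
  | ifLt e f p q, s => 1 + if e.eval s < f.eval s then p.cost s else q.cost s
  | loop x e p, s =>
    1 + ∑ k ∈ Finset.range (e.eval s).toNat, (1 + p.cost ((iterate p.run x s k).setVar x k))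

end Cmd

/-- The store with the input `l`; all variables and all other arrays are zero. -/
def Store.initial (l : List ℤ) : Store where
  var _ := 0
  arr A i := if A = .input then l.getD i 0 else 0

/-! ### Compilation to the random access machine -/

section Compilation

open RAM

/-- The address of entry `i` of the array `A`. The input occupies the cells with nonnegative
addresses, the other arrays are interleaved in the cells with negative addresses. -/
def address : Arr → ℕ → ℤ
  | .input, i => i
  | A, i => -(16 * (i : ℤ) + A.ctorIdx)

theorem Var.ctorIdx_injective : Function.Injective Var.ctorIdx := by
  intro x y h
  cases x <;> cases y <;> first | rfl | contradiction

theorem Var.ctorIdx_lt (x : Var) : x.ctorIdx < 16 := by cases x <;> decide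

theorem Arr.ctorIdx_injective : Function.Injective Arr.ctorIdx := by
  intro A B h
  cases A <;> cases B <;> first | rfl | contradiction

theorem Arr.ctorIdx_lt (A : Arr) : A.ctorIdx < 16 := by cases A <;> decide

theorem address_of_ne {A : Arr} (h : A ≠ .input) (i : ℕ) :
    address A i = -(16 * (i : ℤ) + A.ctorIdx) := by
  cases A <;> first | contradiction | rfl

theorem ctorIdx_pos {A : Arr} (h : A ≠ .input) : 0 < A.ctorIdx :=
  Nat.pos_of_ne_zero fun h0 => h (Arr.ctorIdx_injective h0)

theorem address_inj {A B : Arr} {i j : ℕ} : address A i = address B j ↔ A = B ∧ i = j := by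
  refine ⟨fun h => ?_, fun h => by rw [h.1, h.2]⟩
  have hA := A.ctorIdx_lt
  have hB := B.ctorIdx_lt
  by_cases hAi : A = .input <;> by_cases hBi : B = .input
  · subst hAi hBi
    exact ⟨rfl, Int.ofNat_inj.1 h⟩
  · have := ctorIdx_pos hBi
    rw [hAi, address_of_ne hBi, address] at h
    omega
  · have := ctorIdx_pos hAi
    rw [hBi, address_of_ne hAi, address] at h
    omega
  · rw [address_of_ne hAi, address_of_ne hBi] at h
    exact ⟨Arr.ctorIdx_injective (by omega), by omega⟩

/-- The machine state `σ` represents the store `s`. -/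
structure Represents (σ : State) (s : Store) : Prop where
  var : ∀ x : Var, σ.reg x.ctorIdx = s.var x
  arr : ∀ A i, σ.mem (address A i) = s.arr A i

/-- `σ'` arises from `σ` by changing registers `r_k` with `k ≥ d` only. -/
structure ChangesFrom (d : ℕ) (σ σ' : State) : Prop where
  mem : σ'.mem = σ.mem
  reg : ∀ k < d, σ'.reg k = σ.reg k

theorem ChangesFrom.refl (d : ℕ) (σ : State) : ChangesFrom d σ σ := ⟨rfl, fun _ _ => rfl⟩

theorem ChangesFrom.trans {d e : ℕ} {σ σ₁ σ₂ : State} (h : ChangesFrom d σ σ₁)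
    (h' : ChangesFrom e σ₁ σ₂) (hde : d ≤ e) : ChangesFrom d σ σ₂ :=
  ⟨h'.mem.trans h.mem, fun k hk => (h'.reg k (hk.trans_le hde)).trans (h.reg k hk)⟩

theorem changesFrom_setReg {d e : ℕ} (hde : d ≤ e) (σ : State) (v : ℤ) :
    ChangesFrom d σ (σ.setReg e v) :=
  ⟨rfl, fun _ hk => Function.update_of_ne (hk.trans_le hde).ne _ _⟩

namespace Represents

theorem of_changesFrom {s : Store} {d : ℕ} {σ σ' : State} (h : Represents σ s) (hd : 16 ≤ d)
    (hσ : ChangesFrom d σ σ') : Represents σ' s where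
  var x := (hσ.reg _ (x.ctorIdx_lt.trans_le hd)).trans (h.var x)
  arr A i := by rw [hσ.mem, h.arr]

theorem setVar {s : Store} {σ : State} (h : Represents σ s) (x : Var) (k : ℕ) :
    Represents (σ.setReg x.ctorIdx k) (s.setVar x k) where
  var y := by
    simp only [State.setReg, Store.setVar, Function.update_apply, Var.ctorIdx_injective.eq_iff]
    split_ifs
    · rfl
    · exact h.var y
  arr := h.arr

theorem setArr {s : Store} {σ : State} (h : Represents σ s) (A : Arr) (i : ℕ) (k : ℤ) :
    Represents (σ.setMem (address A i) k) (s.setArr A i k) where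
  var := h.var
  arr B j := by
    simp only [State.setMem, Store.setArr, Function.update_apply, address_inj, h.arr]
    by_cases hB : B = A
    · subst hB
      simp [Function.update_apply]
    · simp [hB]

end Represents

theorem represents_initial (l : List ℤ) : Represents (initial l) (Store.initial l) where
  var _ := rfl
  arr A i := by
    by_cases hA : A = .input
    · subst hA
      simp [initial, Store.initial, address]
    · have := ctorIdx_pos hA
      have hneg : ¬ 0 ≤ address A i := by rw [address_of_ne hA]; omega
      simp [initial, Store.initial, hA, hneg]

/-- `p` computes the value `v` in register `r_d` in `κ` steps, without changing lower registers or
the memory. -/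
def Computes (p : Program) (d κ : ℕ) (σ : State) (v : ℤ) : Prop :=
  ∃ σ', Runs p σ σ' κ ∧ ChangesFrom d σ σ' ∧ σ'.reg d = v

theorem Computes.seq {p q : Program} {d κ κ' : ℕ} {σ : State} {v w : ℤ} (hp : Computes p d κ σ v)
    (hq : ∀ σ', ChangesFrom d σ σ' → σ'.reg d = v → Computes q d κ' σ' w) :
    Computes (.seq p q) d (κ + κ') σ w := by
  obtain ⟨σ₁, hrun₁, hch₁, hreg₁⟩ := hp
  obtain ⟨σ₂, hrun₂, hch₂, hreg₂⟩ := hq σ₁ hch₁ hreg₁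
  exact ⟨σ₂, .seq hrun₁ hrun₂, hch₁.trans hch₂ le_rfl, hreg₂⟩

theorem computes_const (d : ℕ) (σ : State) (c : ℤ) : Computes (.const d c) d 1 σ c :=
  ⟨_, .const _ _ _, changesFrom_setReg le_rfl _ _, by simp [State.setReg]⟩

theorem computes_add (d a b : ℕ) (σ : State) :
    Computes (.add d a b) d 1 σ (σ.reg a + σ.reg b) :=
  ⟨_, .add _ _ _ _, changesFrom_setReg le_rfl _ _, by simp [State.setReg]⟩

theorem computes_sub (d a b : ℕ) (σ : State) :
    Computes (.sub d a b) d 1 σ (σ.reg a - σ.reg b) :=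
  ⟨_, .sub _ _ _ _, changesFrom_setReg le_rfl _ _, by simp [State.setReg]⟩

theorem computes_load (d a : ℕ) (σ : State) : Computes (.load d a) d 1 σ (σ.mem (σ.reg a)) :=
  ⟨_, .load _ _ _, changesFrom_setReg le_rfl _ _, by simp [State.setReg]⟩

/-- The program `r_d := max r_d 0`. -/
def truncate (d : ℕ) : Program := .ifPos d .skip (.const d 0)

theorem computes_truncate (d : ℕ) (σ : State) :
    Computes (truncate d) d 2 σ (σ.reg d).toNat := by
  by_cases h : 0 < σ.reg d
  · exact ⟨σ, .ifTrue h (.skip _), .refl _ _, by omega⟩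
  · obtain ⟨σ', hrun, hch, hreg⟩ := computes_const d σ 0
    exact ⟨σ', .ifFalse h hrun, hch, by omega⟩

/-- The program that replaces an index `i` in `r_d` by the address of entry `i` of `A`. -/
def addressCode : Arr → ℕ → Program
  | .input, _ => .skip
  | A, d => .seq (.add d d d) (.seq (.add d d d) (.seq (.add d d d) (.seq (.add d d d)
      (.seq (.const (d + 1) (-A.ctorIdx)) (.sub d (d + 1) d)))))

theorem computes_addressCode (A : Arr) : ∃ κ, ∀ (d i : ℕ) (σ : State), σ.reg d = i →
    Computes (addressCode A d) d κ σ (address A i) := by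
  by_cases hA : A = .input
  · subst hA
    exact ⟨1, fun d i σ h => ⟨σ, .skip _, .refl _ _, h⟩⟩
  · refine ⟨6, fun d i σ h => ?_⟩
    have hcode : addressCode A d = .seq (.add d d d) (.seq (.add d d d) (.seq (.add d d d)
        (.seq (.add d d d) (.seq (.const (d + 1) (-A.ctorIdx)) (.sub d (d + 1) d))))) := by
      cases A <;> first | contradiction | rfl
    rw [hcode, address_of_ne hA]
    refine ⟨_, .seq (.add _ _ _ _) (.seq (.add _ _ _ _) (.seq (.add _ _ _ _)
      (.seq (.add _ _ _ _) (.seq (.const _ _ _) (.sub _ _ _ _))))), ⟨rfl, fun k hk => ?_⟩, ?_⟩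
    · simp [State.setReg, hk.ne, (hk.trans d.lt_succ_self).ne]
    · simp [State.setReg, h]
      ring

/-- The program that computes the value of an expression in `r_d`. -/
def Exp.compile : Exp → ℕ → Program
  | .lit k, d => .const d k
  | .var x, d => .seq (.const d 0) (.add d d x.ctorIdx)
  | .get A e, d => .seq (.seq (e.compile d) (truncate d)) (.seq (addressCode A d) (.load d d))
  | .add e f, d => .seq (e.compile d) (.seq (f.compile (d + 1)) (.add d d (d + 1)))
  | .sub e f, d => .seq (e.compile d) (.seq (f.compile (d + 1)) (.sub d d (d + 1)))

/-- The program that computes the value of an expression, or `0` if it is negative, in `r_d`. -/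
def Exp.compileNat (e : Exp) (d : ℕ) : Program := .seq (e.compile d) (truncate d)

/-- The program for `x := r_d`. -/
def setVarCode (x : Var) (d : ℕ) : Program :=
  .seq (.const x.ctorIdx 0) (.add x.ctorIdx x.ctorIdx d)

/-- The body of a compiled loop: `r_d` counts the remaining rounds, `r_{d+1}` the rounds so far,
and `r_{d+2}` holds `1`. -/
def loopBody (x : Var) (p : Program) (d : ℕ) : Program :=
  .seq (setVarCode x (d + 1)) (.seq p (.seq (.add (d + 1) (d + 1) (d + 2)) (.sub d d (d + 2))))

/-- The program that executes a command, using registers from `r_d` on for intermediate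
results. -/
def Cmd.compile : Cmd → ℕ → Program
  | .skip, _ => .skip
  | .set x e, d => .seq (e.compileNat d) (setVarCode x d)
  | .put A e f, d => .seq (e.compileNat d) (.seq (addressCode A d)
      (.seq (f.compile (d + 1)) (.store d (d + 1))))
  | .seq p q, d => .seq (p.compile d) (q.compile d)
  | .ifLt e f p q, d => .seq ((f - e).compile d) (.ifPos d (p.compile d) (q.compile d))
  | .loop x e p, d => .seq (e.compileNat d) (.seq (.const (d + 1) 0) (.seq (.const (d + 2) 1)
      (.whilePos d (loopBody x (p.compile (d + 3)) d))))

/-- The value of the expression `e` is computed in `κ` steps. -/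
def Exp.CompilesTo (e : Exp) (κ : ℕ) : Prop :=
  ∀ (d : ℕ) (s : Store) (σ : State), 16 ≤ d → Represents σ s →
    Computes (e.compile d) d κ σ (e.eval s)

theorem Exp.CompilesTo.toNat {e : Exp} {κ : ℕ} (he : e.CompilesTo κ) {d : ℕ} {s : Store}
    {σ : State} (hd : 16 ≤ d) (hσ : Represents σ s) :
    Computes (e.compileNat d) d (κ + 2) σ (e.eval s).toNat :=
  (he d s σ hd hσ).seq fun σ' _ hreg => hreg ▸ computes_truncate d σ'

theorem computes_binary {e f : Exp} {κ₁ κ₂ : ℕ} (he : e.CompilesTo κ₁) (hf : f.CompilesTo κ₂)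
    {op : Program} {g : ℤ → ℤ → ℤ} {d : ℕ} {s : Store} {σ : State} (hd : 16 ≤ d)
    (hσ : Represents σ s)
    (hop : ∀ σ' : State, Computes op d 1 σ' (g (σ'.reg d) (σ'.reg (d + 1)))) :
    Computes (.seq (e.compile d) (.seq (f.compile (d + 1)) op)) d (κ₁ + (κ₂ + 1)) σ
      (g (e.eval s) (f.eval s)) := by
  refine (he d s σ hd hσ).seq fun σ₁ hch₁ hreg₁ => ?_
  obtain ⟨σ₂, hrun₂, hch₂, hreg₂⟩ := hf (d + 1) s σ₁ (by omega) (hσ.of_changesFrom hd hch₁)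
  obtain ⟨σ₃, hrun₃, hch₃, hreg₃⟩ := hop σ₂
  refine ⟨σ₃, .seq hrun₂ hrun₃, ⟨hch₃.mem.trans hch₂.mem, fun k hk => ?_⟩, ?_⟩
  · rw [hch₃.reg k hk, hch₂.reg k (by omega)]
  · rw [hreg₃, hreg₂, hch₂.reg d d.lt_succ_self, hreg₁]

theorem Exp.exists_compilesTo (e : Exp) : ∃ κ, e.CompilesTo κ := by
  induction e with
  | lit k => exact ⟨1, fun d s σ _ _ => computes_const d σ k⟩
  | var x =>
    refine ⟨1 + 1, fun d s σ hd hσ => (computes_const d σ 0).seq fun σ' hch hreg => ?_⟩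
    have hx : σ'.reg x.ctorIdx = s.var x := (hσ.of_changesFrom hd hch).var x
    simpa only [hreg, hx, zero_add, Exp.eval] using computes_add d d x.ctorIdx σ'
  | get A e ih =>
    obtain ⟨κ, hκ⟩ := ih
    obtain ⟨κ', hκ'⟩ := computes_addressCode A
    refine ⟨κ + 2 + (κ' + 1), fun d s σ hd hσ => (hκ.toNat hd hσ).seq fun σ₁ hch₁ hreg₁ =>
      (hκ' d _ σ₁ hreg₁).seq fun σ₂ hch₂ hreg₂ => ?_⟩
    have hσ₂ := (hσ.of_changesFrom hd hch₁).of_changesFrom hd hch₂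
    simpa only [hreg₂, hσ₂.arr, Exp.eval] using computes_load d d σ₂
  | add e f ihe ihf =>
    obtain ⟨κ₁, he⟩ := ihe
    obtain ⟨κ₂, hf⟩ := ihf
    exact ⟨_, fun d s σ hd hσ => computes_binary he hf hd hσ fun σ' => computes_add _ _ _ σ'⟩
  | sub e f ihe ihf =>
    obtain ⟨κ₁, he⟩ := ihe
    obtain ⟨κ₂, hf⟩ := ihf
    exact ⟨_, fun d s σ hd hσ => computes_binary he hf hd hσ fun σ' => computes_sub _ _ _ σ'⟩

/-- The compiled command simulates `c` with at most `κ` steps for each unit of cost. -/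
def Cmd.CompilesTo (c : Cmd) (κ : ℕ) : Prop :=
  ∀ (d : ℕ) (s : Store) (σ : State), 16 ≤ d → Represents σ s →
    ∃ σ' τ, Runs (c.compile d) σ σ' τ ∧ τ ≤ κ * c.cost s ∧ Represents σ' (c.run s) ∧
      ∀ k, 16 ≤ k → k < d → σ'.reg k = σ.reg k

theorem setReg_ctorIdx_of_le {k : ℕ} (hk : 16 ≤ k) (x : Var) (σ : State) (v : ℤ) :
    (σ.setReg x.ctorIdx v).reg k = σ.reg k :=
  Function.update_of_ne (x.ctorIdx_lt.trans_le hk).ne' _ _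

theorem runs_setVarCode {d : ℕ} (hd : 16 ≤ d) (x : Var) (σ : State) :
    Runs (setVarCode x d) σ (σ.setReg x.ctorIdx (σ.reg d)) 2 := by
  have hfinal : ((σ.setReg x.ctorIdx 0).setReg x.ctorIdx
      ((σ.setReg x.ctorIdx 0).reg x.ctorIdx + (σ.setReg x.ctorIdx 0).reg d)) =
      σ.setReg x.ctorIdx (σ.reg d) := by
    rw [setReg_ctorIdx_of_le hd]
    simp [State.setReg]
  exact hfinal ▸ .seq (.const _ _ _) (.add _ _ _ _)

namespace Cmd

theorem CompilesTo.mono {c : Cmd} {κ κ' : ℕ} (h : c.CompilesTo κ) (hκ : κ ≤ κ') :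
    c.CompilesTo κ' := fun d s σ hd hσ =>
  let ⟨σ', τ, hrun, hτ, hrest⟩ := h d s σ hd hσ
  ⟨σ', τ, hrun, hτ.trans (Nat.mul_le_mul_right _ hκ), hrest⟩

theorem compilesTo_skip : CompilesTo .skip 1 := fun _ _ σ _ hσ =>
  ⟨σ, 1, .skip σ, by simp [cost], hσ, fun _ _ _ => rfl⟩

theorem exists_compilesTo_set (x : Var) (e : Exp) : ∃ κ, (set x e).CompilesTo κ := by
  obtain ⟨κ, hκ⟩ := e.exists_compilesTo
  refine ⟨κ + 2 + 2, fun d s σ hd hσ => ?_⟩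
  obtain ⟨σ₁, hrun, hch, hreg⟩ := hκ.toNat hd hσ
  refine ⟨_, _, .seq hrun (runs_setVarCode hd x σ₁), by simp [cost], ?_, fun k hk hkd => ?_⟩
  · rw [hreg]
    exact (hσ.of_changesFrom hd hch).setVar x _
  · rw [setReg_ctorIdx_of_le hk, hch.reg k hkd]

theorem exists_compilesTo_put (A : Arr) (e f : Exp) : ∃ κ, (put A e f).CompilesTo κ := by
  obtain ⟨κ₁, he⟩ := e.exists_compilesTo
  obtain ⟨κ₂, hA⟩ := computes_addressCode A
  obtain ⟨κ₃, hf⟩ := f.exists_compilesTo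
  refine ⟨κ₁ + 2 + (κ₂ + (κ₃ + 1)), fun d s σ hd hσ => ?_⟩
  obtain ⟨σ₁, hrun₁, hch₁, hreg₁⟩ := he.toNat hd hσ
  obtain ⟨σ₂, hrun₂, hch₂, hreg₂⟩ := hA d _ σ₁ hreg₁
  have hch₂ := hch₁.trans hch₂ le_rfl
  obtain ⟨σ₃, hrun₃, hch₃, hreg₃⟩ := hf (d + 1) s σ₂ (by omega) (hσ.of_changesFrom hd hch₂)
  have hch := hch₂.trans hch₃ d.le_succ
  refine ⟨_, _, .seq hrun₁ (.seq hrun₂ (.seq hrun₃ (.store _ _ _))), by simp [cost], ?_,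
    fun k _ hkd => hch.reg k hkd⟩
  rw [hreg₃, hch₃.reg d d.lt_succ_self, hreg₂]
  exact (hσ.of_changesFrom hd hch).setArr A _ _

theorem CompilesTo.seq {p q : Cmd} {κ : ℕ} (hp : p.CompilesTo κ) (hq : q.CompilesTo κ) :
    (p ;; q).CompilesTo κ := fun d s σ hd hσ => by
  obtain ⟨σ₁, τ₁, hrun₁, hτ₁, hσ₁, hreg₁⟩ := hp d s σ hd hσ
  obtain ⟨σ₂, τ₂, hrun₂, hτ₂, hσ₂, hreg₂⟩ := hq d _ σ₁ hd hσ₁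
  refine ⟨σ₂, _, .seq hrun₁ hrun₂, ?_, hσ₂, fun k hk hkd => (hreg₂ k hk hkd).trans (hreg₁ k hk hkd)⟩
  rw [cost, mul_add]
  exact add_le_add hτ₁ hτ₂

theorem CompilesTo.ifLt {e f : Exp} {p q : Cmd} {κ κ' : ℕ} (hef : (f - e).CompilesTo κ)
    (hp : p.CompilesTo κ') (hq : q.CompilesTo κ') : (ifLt e f p q).CompilesTo (κ + 1 + κ') :=
  fun d s σ hd hσ => by
    obtain ⟨σ₁, hrun₁, hch₁, hreg₁⟩ := hef d s σ hd hσ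
    have hσ₁ := hσ.of_changesFrom hd hch₁
    rw [Exp.eval_sub] at hreg₁
    by_cases hlt : e.eval s < f.eval s
    · obtain ⟨σ₂, τ, hrun, hτ, hσ₂, hreg⟩ := hp d s σ₁ hd hσ₁
      refine ⟨σ₂, _, .seq hrun₁ (.ifTrue (by omega) hrun), ?_, by simpa [run, hlt] using hσ₂,
        fun k hk hkd => (hreg k hk hkd).trans (hch₁.reg k hkd)⟩
      simp only [cost, hlt, if_true]
      nlinarith
    · obtain ⟨σ₂, τ, hrun, hτ, hσ₂, hreg⟩ := hq d s σ₁ hd hσ₁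
      refine ⟨σ₂, _, .seq hrun₁ (.ifFalse (by omega) hrun), ?_, by simpa [run, hlt] using hσ₂,
        fun k hk hkd => (hreg k hk hkd).trans (hch₁.reg k hkd)⟩
      simp only [cost, hlt, if_false]
      nlinarith

theorem runs_updateCounters {d k r : ℕ} {σ : State} (hremaining : σ.reg d = (r + 1 : ℕ))
    (hdone : σ.reg (d + 1) = k) (hone : σ.reg (d + 2) = 1) :
    Runs (.seq (.add (d + 1) (d + 1) (d + 2)) (.sub d d (d + 2))) σ
      ((σ.setReg (d + 1) (k + 1 : ℕ)).setReg d r) 2 := by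
  have hadd := Runs.add σ (d + 1) (d + 1) (d + 2)
  have hsub := Runs.sub (σ.setReg (d + 1) (k + 1 : ℕ)) d d (d + 2)
  simp only [hdone, hone] at hadd
  simp only [State.setReg, Function.update_of_ne d.succ_ne_self.symm, hremaining,
    Function.update_of_ne (d + 1).succ_ne_self, hone, Nat.cast_succ, add_sub_cancel_right] at hsub
  exact .seq hadd (by simpa [State.setReg] using hsub)

/-- The state `σ` of a compiled loop with `r` remaining rounds after `k` rounds. -/
structure AtRound (x : Var) (p : Cmd) (s : Store) (d k r : ℕ) (σ : State) : Prop where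
  represents : Represents σ (iterate p.run x s k)
  remaining : σ.reg d = r
  done : σ.reg (d + 1) = k
  one : σ.reg (d + 2) = 1

theorem CompilesTo.runs_loopBody {x : Var} {p : Cmd} {κ : ℕ} (hp : p.CompilesTo κ) {s : Store}
    {d k r : ℕ} (hd : 16 ≤ d) {σ : State} (hσ : AtRound x p s d k (r + 1) σ) :
    ∃ σ' τ, Runs (loopBody x (p.compile (d + 3)) d) σ σ' τ ∧
      τ ≤ 4 + κ * p.cost ((iterate p.run x s k).setVar x k) ∧ AtRound x p s d (k + 1) r σ' ∧
      ∀ k, 16 ≤ k → k < d → σ'.reg k = σ.reg k := by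
  have hset := runs_setVarCode (hd.trans d.le_succ) x σ
  rw [hσ.done] at hset
  obtain ⟨σ₁, τ, hrun, hτ, hσ₁, hreg⟩ := hp (d + 3) _ _ (by omega) (hσ.represents.setVar x k)
  have hkeep : ∀ j, 16 ≤ j → j < d + 3 → σ₁.reg j = σ.reg j := fun j hj hjd =>
    (hreg j hj hjd).trans (setReg_ctorIdx_of_le hj x σ _)
  have hcount := runs_updateCounters ((hkeep d hd (by omega)).trans hσ.remaining)
    ((hkeep (d + 1) (by omega) (by omega)).trans hσ.done)
    ((hkeep (d + 2) (by omega) (by omega)).trans hσ.one)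
  have hch := (changesFrom_setReg d.le_succ σ₁ ((k + 1 : ℕ) : ℤ)).trans
    (changesFrom_setReg le_rfl _ (r : ℤ)) le_rfl
  refine ⟨_, _, .seq hset (.seq hrun hcount), by omega,
    ⟨hσ₁.of_changesFrom hd hch, by simp [State.setReg], by simp [State.setReg], ?_⟩,
    fun j hj hjd => ?_⟩
  · simpa [State.setReg] using (hkeep (d + 2) (by omega) (by omega)).trans hσ.one
  · rw [hch.reg j hjd, hkeep j hj (by omega)]

theorem CompilesTo.runs_whilePos {x : Var} {p : Cmd} {κ : ℕ} (hp : p.CompilesTo κ) {s : Store}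
    {d : ℕ} (hd : 16 ≤ d) (r : ℕ) : ∀ (k : ℕ) (σ : State), AtRound x p s d k r σ →
    ∃ σ' τ, Runs (.whilePos d (loopBody x (p.compile (d + 3)) d)) σ σ' τ ∧
      τ ≤ 1 + ∑ i ∈ Finset.Ico k (k + r), (5 + κ * p.cost ((iterate p.run x s i).setVar x i)) ∧
      Represents σ' (iterate p.run x s (k + r)) ∧ ∀ k, 16 ≤ k → k < d → σ'.reg k = σ.reg k := by
  induction r with
  | zero =>
    intro k σ hσ
    exact ⟨σ, 1, .whileFalse (by simp [hσ.remaining]), by simp, hσ.represents, fun _ _ _ => rfl⟩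
  | succ r ih =>
    intro k σ hσ
    obtain ⟨σ₁, τ₁, hrun₁, hτ₁, hσ₁, hreg₁⟩ := hp.runs_loopBody hd hσ
    obtain ⟨σ₂, τ₂, hrun₂, hτ₂, hσ₂, hreg₂⟩ := ih (k + 1) σ₁ hσ₁
    rw [show k + 1 + r = k + (r + 1) by omega] at hτ₂ hσ₂
    refine ⟨σ₂, _, .whileTrue (by rw [hσ.remaining]; omega) hrun₁ hrun₂, ?_, hσ₂,
      fun j hj hjd => (hreg₂ j hj hjd).trans (hreg₁ j hj hjd)⟩
    rw [Finset.sum_eq_sum_Ico_succ_bot (by omega : k < k + (r + 1))]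
    omega

theorem CompilesTo.loop {x : Var} {e : Exp} {p : Cmd} {κ κ' : ℕ} (he : e.CompilesTo κ)
    (hp : p.CompilesTo κ') : (loop x e p).CompilesTo (κ + κ' + 5) := fun d s σ hd hσ => by
  obtain ⟨σ₁, hrun₁, hch₁, hreg₁⟩ := he.toNat hd hσ
  have hch := (hch₁.trans (changesFrom_setReg d.le_succ σ₁ 0) le_rfl).trans
    (changesFrom_setReg (Nat.le_add_right d 2) _ 1) le_rfl
  obtain ⟨σ₂, τ, hrun₂, hτ, hσ₂, hreg₂⟩ := hp.runs_whilePos (x := x) hd (e.eval s).toNat 0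
    ((σ₁.setReg (d + 1) 0).setReg (d + 2) 1) ⟨hσ.of_changesFrom hd hch,
      by simp [State.setReg, hreg₁], by simp [State.setReg], by simp [State.setReg]⟩
  refine ⟨σ₂, _, .seq hrun₁ (.seq (.const _ _ _) (.seq (.const _ _ _) hrun₂)), ?_,
    by simpa only [zero_add, run] using hσ₂, fun k hk hkd => (hreg₂ k hk hkd).trans (hch.reg k hkd)⟩
  have hrounds : ∑ i ∈ Finset.range (e.eval s).toNat,
        (5 + κ' * p.cost ((iterate p.run x s i).setVar x i)) ≤
      (κ + κ' + 5) * ∑ i ∈ Finset.range (e.eval s).toNat,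
        (1 + p.cost ((iterate p.run x s i).setVar x i)) := by
    rw [Finset.mul_sum]
    refine Finset.sum_le_sum fun i _ => ?_
    nlinarith [Nat.zero_le ((κ + 5) * p.cost ((iterate p.run x s i).setVar x i))]
  rw [zero_add, ← Finset.range_eq_Ico] at hτ
  rw [cost, mul_add]
  omega

theorem exists_compilesTo (c : Cmd) : ∃ κ, c.CompilesTo κ := by
  induction c with
  | skip => exact ⟨1, compilesTo_skip⟩
  | set x e => exact exists_compilesTo_set x e
  | put A e f => exact exists_compilesTo_put A e f
  | seq p q ihp ihq =>
    obtain ⟨κ₁, hp⟩ := ihp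
    obtain ⟨κ₂, hq⟩ := ihq
    exact ⟨max κ₁ κ₂, (hp.mono (le_max_left _ _)).seq (hq.mono (le_max_right _ _))⟩
  | ifLt e f p q ihp ihq =>
    obtain ⟨κ, hef⟩ := (f - e).exists_compilesTo
    obtain ⟨κ₁, hp⟩ := ihp
    obtain ⟨κ₂, hq⟩ := ihq
    exact ⟨_, .ifLt hef (hp.mono (le_max_left κ₁ κ₂)) (hq.mono (le_max_right κ₁ κ₂))⟩
  | loop x e p ih =>
    obtain ⟨κ₁, he⟩ := e.exists_compilesTo
    obtain ⟨κ₂, hp⟩ := ih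
    exact ⟨_, .loop he hp⟩

end Cmd

theorem Cmd.exists_runs (c : Cmd) : ∃ (P : Program) (κ : ℕ), ∀ l : List ℤ,
    ∃ (σ : State) (τ : ℕ), Runs P (initial l) σ τ ∧ τ ≤ κ * c.cost (Store.initial l) ∧
      ∀ i : ℕ, σ.mem i = (c.run (Store.initial l)).arr .input i := by
  obtain ⟨κ, hκ⟩ := c.exists_compilesTo
  refine ⟨c.compile 16, κ, fun l => ?_⟩
  obtain ⟨σ, τ, hrun, hτ, hσ, -⟩ := hκ 16 _ _ le_rfl (represents_initial l)
  exact ⟨σ, τ, hrun, hτ, fun i => hσ.arr .input i⟩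

end Compilation

/-! ### Reasoning about commands -/

namespace Cmd

/-- The variables to which a command assigns. -/
def assigned : Cmd → List Var
  | skip => []
  | set x _ => [x]
  | put _ _ _ => []
  | seq p q => p.assigned ++ q.assigned
  | ifLt _ _ p q => p.assigned ++ q.assigned
  | loop x _ p => x :: p.assigned

/-- The arrays to which a command assigns. -/
def modified : Cmd → List Arr
  | skip => []
  | set _ _ => []
  | put A _ _ => [A]
  | seq p q => p.modified ++ q.modified
  | ifLt _ _ p q => p.modified ++ q.modified
  | loop _ _ p => p.modified

/-- The store `s'` differs from `s` only in variables and arrays to which `c` assigns. -/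
structure Frame (c : Cmd) (s s' : Store) : Prop where
  var : ∀ x, x ∉ c.assigned → s'.var x = s.var x
  arr : ∀ A, A ∉ c.modified → s'.arr A = s.arr A

namespace Frame

theorem refl (c : Cmd) (s : Store) : Frame c s s := ⟨fun _ _ => rfl, fun _ _ => rfl⟩

theorem trans {c : Cmd} {s s₁ s₂ : Store} (h₁ : Frame c s s₁) (h₂ : Frame c s₁ s₂) :
    Frame c s s₂ :=
  ⟨fun x hx => (h₂.var x hx).trans (h₁.var x hx), fun A hA => (h₂.arr A hA).trans (h₁.arr A hA)⟩

theorem mono {c c' : Cmd} {s s' : Store} (h : Frame c s s') (hv : c.assigned ⊆ c'.assigned)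
    (ha : c.modified ⊆ c'.modified) : Frame c' s s' :=
  ⟨fun x hx => h.var x fun hx' => hx (hv hx'), fun A hA => h.arr A fun hA' => hA (ha hA')⟩

end Frame

theorem frame_iterate {x : Var} {e : Exp} {p : Cmd} (hp : ∀ s, Frame p s (p.run s)) (s : Store)
    (k : ℕ) : Frame (loop x e p) s (iterate p.run x s k) := by
  induction k with
  | zero => exact .refl _ _
  | succ k ih =>
    have hset : Frame (loop x e p) (iterate p.run x s k) ((iterate p.run x s k).setVar x k) :=
      ⟨fun y hy => Store.setVar_var_of_ne _ (List.ne_of_not_mem_cons hy) _, fun _ _ => rfl⟩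
    exact (ih.trans hset).trans ((hp _).mono (List.subset_cons_self _ _) (List.Subset.refl _))

theorem frame_run (c : Cmd) (s : Store) : Frame c s (c.run s) := by
  induction c generalizing s with
  | skip => exact .refl _ _
  | set x e =>
    exact ⟨fun y hy => Store.setVar_var_of_ne _ (List.ne_of_not_mem_cons hy) _, fun _ _ => rfl⟩
  | put A e f =>
    exact ⟨fun _ _ => rfl, fun B hB => Store.setArr_arr_of_ne _ (List.ne_of_not_mem_cons hB) _ _⟩
  | seq p q ihp ihq =>
    exact ((ihp s).mono (List.subset_append_left _ _) (List.subset_append_left _ _)).trans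
      ((ihq _).mono (List.subset_append_right _ _) (List.subset_append_right _ _))
  | ifLt e f p q ihp ihq =>
    rw [run]
    split_ifs
    · exact (ihp s).mono (List.subset_append_left _ _) (List.subset_append_left _ _)
    · exact (ihq s).mono (List.subset_append_right _ _) (List.subset_append_right _ _)
  | loop x e p ih => exact frame_iterate ih s _

/-- Started in the store `s`, the command `c` has cost at most `B` and ends in a store with the
property `Q`. -/
def Ensures (c : Cmd) (s : Store) (B : ℕ) (Q : Store → Prop) : Prop :=
  c.cost s ≤ B ∧ Q (c.run s)

namespace Ensures

variable {c p q : Cmd} {s : Store} {x : Var} {A : Arr} {e f : Exp} {B B' : ℕ}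
  {Q Q' R : Store → Prop}

theorem mono (h : Ensures c s B Q) (hB : B ≤ B') (hQ : ∀ s', Frame c s s' → Q s' → Q' s') :
    Ensures c s B' Q' :=
  ⟨h.1.trans hB, hQ _ (frame_run c s) h.2⟩

theorem skip (h : Q s) : Ensures .skip s 1 Q := ⟨le_rfl, h⟩

theorem set (h : Q (s.setVar x (e.eval s).toNat)) : Ensures (.set x e) s 1 Q := ⟨le_rfl, h⟩

theorem put (h : Q (s.setArr A (e.eval s).toNat (f.eval s))) : Ensures (.put A e f) s 1 Q :=
  ⟨le_rfl, h⟩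

theorem seq (hp : Ensures p s B R) (hq : ∀ s', Frame p s s' → R s' → Ensures q s' B' Q) :
    Ensures (p ;; q) s (B + B') Q :=
  have h := hq _ (frame_run p s) hp.2
  ⟨Nat.add_le_add hp.1 h.1, h.2⟩

theorem ifLt (hp : e.eval s < f.eval s → Ensures p s B Q)
    (hq : f.eval s ≤ e.eval s → Ensures q s B Q) : Ensures (.ifLt e f p q) s (1 + B) Q := by
  by_cases h : e.eval s < f.eval s
  · simpa [Ensures, cost, run, h] using hp h
  · simpa [Ensures, cost, run, h] using hq (not_lt.1 h)

theorem loop {N : ℕ} (hN : e.eval s = N) (B : ℕ → ℕ) (Inv : ℕ → Store → Prop) (h0 : Inv 0 s)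
    (hstep : ∀ k < N, ∀ s', Frame (.loop x e p) s s' → s'.var x = k → Inv k s' →
      Ensures p s' (B k) (Inv (k + 1)))
    (hset : ∀ k s', Inv k s' → Inv k (s'.setVar x k) := by exact fun _ _ h => h) :
    Ensures (.loop x e p) s (1 + ∑ k ∈ Finset.range N, (1 + B k)) (Inv N) := by
  have hround : ∀ k < N, Inv k (iterate p.run x s k) →
      Ensures p ((iterate p.run x s k).setVar x k) (B k) (Inv (k + 1)) := fun k hk h =>
    hstep k hk _ ((frame_iterate (frame_run p) s k).trans
      ⟨fun y hy => Store.setVar_var_of_ne _ (List.ne_of_not_mem_cons hy) _, fun _ _ => rfl⟩)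
      (Store.setVar_var_self _ _ _) (hset k _ h)
  have hinv : ∀ k ≤ N, Inv k (iterate p.run x s k) := by
    intro k hk
    induction k with
    | zero => exact h0
    | succ k ih => exact (hround k hk (ih (Nat.le_of_succ_le hk))).2
  rw [Ensures, cost, run, hN, Int.toNat_natCast]
  refine ⟨?_, hinv N le_rfl⟩
  gcongr with k hk
  rw [Finset.mem_range] at hk
  exact (hround k hk (hinv k hk.le)).1

theorem loop_const {N : ℕ} (hN : e.eval s = N) (Inv : ℕ → Store → Prop) (h0 : Inv 0 s)
    (hstep : ∀ k < N, ∀ s', Frame (.loop x e p) s s' → s'.var x = k → Inv k s' →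
      Ensures p s' B (Inv (k + 1)))
    (hset : ∀ k s', Inv k s' → Inv k (s'.setVar x k) := by exact fun _ _ h => h) :
    Ensures (.loop x e p) s (1 + N * (1 + B)) (Inv N) :=
  (loop hN (fun _ => B) Inv h0 hstep hset).mono (by simp) fun _ _ h => h

end Ensures

end Cmd

/-! ### Binary numbers -/

/-- The number with the binary digits `y 0, …, y (b - 1)`, least significant digit first. It encodes
the subset `{l < b | y l}`. -/
def binary (b : ℕ) (y : ℕ → Bool) : ℕ := ∑ l ∈ Finset.range b, (y l).toNat * 2 ^ l

theorem binary_succ (b : ℕ) (y : ℕ → Bool) :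
    binary (b + 1) y = binary b y + (y b).toNat * 2 ^ b := by
  rw [binary, binary, Finset.sum_range_succ]

theorem binary_lt (b : ℕ) (y : ℕ → Bool) : binary b y < 2 ^ b := by
  induction b with
  | zero => simp [binary]
  | succ b ih =>
    have := Bool.toNat_le (y b)
    rw [binary_succ, pow_succ]
    nlinarith

theorem binary_congr {b : ℕ} {y z : ℕ → Bool} (h : ∀ l < b, y l = z l) : binary b y = binary b z :=
  Finset.sum_congr rfl fun l hl => by rw [h l (Finset.mem_range.1 hl)]

theorem binary_testBit (b k : ℕ) : binary b k.testBit = k % 2 ^ b := by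
  induction b with
  | zero => simp [binary, Nat.mod_one]
  | succ b ih => rw [binary_succ, ih, Nat.toNat_testBit, Nat.mod_pow_succ, mul_comm (2 ^ b)]

theorem testBit_binary {b l : ℕ} (hl : l < b) (y : ℕ → Bool) : (binary b y).testBit l = y l := by
  induction b with
  | zero => omega
  | succ b ih =>
    rw [binary_succ, mul_comm, add_comm, Nat.testBit_two_pow_mul_add _ (binary_lt b y)]
    split_ifs with h
    · exact ih h
    · obtain rfl : l = b := by omega
      cases y l <;> simp

theorem eq_of_binary_eq {b : ℕ} {y z : ℕ → Bool} (h : binary b y = binary b z) :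
    ∀ l < b, y l = z l := fun l hl => by
  rw [← testBit_binary hl y, h, testBit_binary hl z]

/-! ### Rooted instances -/

/-- A sum of terms `w x_i x_j` in variables `0, …, numVars - 1` with a rooted tree decomposition of
its primal graph. The bag of a node `t < numNodes` has the elements `elem t l` with
`l < (bag t).card`; the bags of all other `t` are empty. -/
structure RootedInstance where
  numVars : ℕ
  numTerms : ℕ
  numNodes : ℕ
  left : ℕ → ℕ
  right : ℕ → ℕ
  weight : ℕ → ℤ
  parent : ℕ → ℕ
  bag : ℕ → Finset ℕ
  elem : ℕ → ℕ → ℕ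
  bijOn_elem : ∀ t, Set.BijOn (elem t) (Set.Iio (bag t).card) (bag t)
  node_lt_of_mem : ∀ t, ∀ v ∈ bag t, t < numNodes
  lt_of_mem : ∀ t, ∀ v ∈ bag t, v < numVars
  exists_mem : ∀ v < numVars, ∃ t, v ∈ bag t
  parent_lt : ∀ t, 0 < t → parent t < t
  mem_parent : ∀ t u v, u < t → v ∈ bag u → v ∈ bag t → v ∈ bag (parent t)
  exists_mem_term : ∀ q < numTerms, ∃ t, left q ∈ bag t ∧ right q ∈ bag t

namespace RootedInstance

variable (I : RootedInstance)

/-- The topmost node whose bag contains the variable `v`. -/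
noncomputable def top (v : ℕ) : ℕ := sInf {t | v ∈ I.bag t}

/-- The node whose table receives the term `q`. -/
noncomputable def home (q : ℕ) : ℕ := max (I.top (I.left q)) (I.top (I.right q))

/-- The value of the term `q` at `x`. -/
def term (q : ℕ) (x : ℕ → Bool) : ℤ := if x (I.left q) && x (I.right q) then I.weight q else 0

/-- The value of the Hamiltonian at `x`. -/
def energy (x : ℕ → Bool) : ℤ := ∑ q ∈ Finset.range I.numTerms, I.term q x

/-- The number of entries of the table of the node `t`. -/
def tableSize (t : ℕ) : ℕ := 2 ^ (I.bag t).card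

/-- The index of the restriction of `x` to the bag of `t` in the table of `t`. -/
def idx (t : ℕ) (x : ℕ → Bool) : ℕ := binary (I.bag t).card fun l => x (I.elem t l)

/-- The assignment which agrees with `x` on the variables whose topmost node precedes `t`, and is
`false` on all others. Within the bag of `t`, the former are the separator of `t` from its
parent. -/
noncomputable def above (t : ℕ) (x : ℕ → Bool) : ℕ → Bool := fun v => decide (I.top v < t) && x v

/-- The index of the restriction of `x` to the separator of `t` from its parent. -/
noncomputable def sepIdx (t : ℕ) (x : ℕ → Bool) : ℕ := I.idx t (I.above t x)

/-- The position of the table of the node `t` if the tables are stored consecutively. -/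
def offset (t : ℕ) : ℕ := ∑ u ∈ Finset.range t, I.tableSize u

/-- The position of the description of the node `t` in the input. -/
def start (t : ℕ) : ℕ := 3 + 3 * I.numTerms + ∑ u ∈ Finset.range t, (2 + (I.bag u).card)

variable {I} {q t u v l : ℕ} {x y : ℕ → Bool}

theorem elem_mem (hl : l < (I.bag t).card) : I.elem t l ∈ I.bag t := (I.bijOn_elem t).mapsTo hl

theorem exists_elem_eq (hv : v ∈ I.bag t) : ∃ l < (I.bag t).card, I.elem t l = v :=
  (I.bijOn_elem t).surjOn hv

theorem mem_bag_iff : v ∈ I.bag t ↔ ∃ l < (I.bag t).card, I.elem t l = v :=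
  ⟨exists_elem_eq, fun ⟨_, hl, h⟩ => h ▸ elem_mem hl⟩

theorem elem_inj {k : ℕ} (hk : k < (I.bag t).card) (hl : l < (I.bag t).card) :
    I.elem t k = I.elem t l ↔ k = l :=
  (I.bijOn_elem t).injOn.eq_iff hk hl

theorem sum_elem {M : Type*} [AddCommMonoid M] (t : ℕ) (f : ℕ → M) :
    ∑ l ∈ Finset.range (I.bag t).card, f (I.elem t l) = ∑ v ∈ I.bag t, f v :=
  Finset.sum_nbij (I.elem t) (fun _ hl => elem_mem (Finset.mem_range.1 hl))
    (by simpa using (I.bijOn_elem t).injOn) (by simpa using (I.bijOn_elem t).surjOn) fun _ _ => rfl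

theorem card_bag_le (t : ℕ) : (I.bag t).card ≤ I.numVars := by
  simpa using Finset.card_le_card fun v hv => Finset.mem_range.2 (I.lt_of_mem t v hv)

theorem top_le (hv : v ∈ I.bag t) : I.top v ≤ t := Nat.sInf_le hv

theorem mem_top (hv : v ∈ I.bag t) : v ∈ I.bag (I.top v) :=
  Nat.sInf_mem (s := {t | v ∈ I.bag t}) ⟨t, hv⟩

theorem top_eq (hv : v ∈ I.bag t) (h : ∀ u < t, v ∉ I.bag u) : I.top v = t :=
  (top_le hv).antisymm (not_lt.1 fun hlt => h _ hlt (mem_top hv))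

theorem mem_parent_of_top_lt (hv : v ∈ I.bag t) (h : I.top v < t) : v ∈ I.bag (I.parent t) :=
  I.mem_parent t (I.top v) v h (mem_top hv) hv

/-- A bag that contains two variables can be moved up until it is the topmost bag of one of them. -/
theorem mem_max_top (hu : u ∈ I.bag t) (hv : v ∈ I.bag t) :
    u ∈ I.bag (max (I.top u) (I.top v)) ∧ v ∈ I.bag (max (I.top u) (I.top v)) := by
  induction t using Nat.strong_induction_on with
  | h t ih =>
    rcases (max_le (top_le hu) (top_le hv)).eq_or_lt with h | h
    · rw [h]
      exact ⟨hu, hv⟩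
    · rw [max_lt_iff] at h
      exact ih _ (I.parent_lt t (Nat.zero_lt_of_lt h.1)) (mem_parent_of_top_lt hu h.1)
        (mem_parent_of_top_lt hv h.2)

theorem left_mem_home (hq : q < I.numTerms) : I.left q ∈ I.bag (I.home q) :=
  have ⟨_, hl, hr⟩ := I.exists_mem_term q hq
  (mem_max_top hl hr).1

theorem right_mem_home (hq : q < I.numTerms) : I.right q ∈ I.bag (I.home q) :=
  have ⟨_, hl, hr⟩ := I.exists_mem_term q hq
  (mem_max_top hl hr).2

theorem home_lt (hq : q < I.numTerms) : I.home q < I.numNodes :=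
  I.node_lt_of_mem _ _ (left_mem_home hq)

theorem idx_lt (t : ℕ) (x : ℕ → Bool) : I.idx t x < I.tableSize t := binary_lt _ _

theorem sepIdx_lt (t : ℕ) (x : ℕ → Bool) : I.sepIdx t x < I.tableSize t := idx_lt _ _

theorem idx_congr (h : ∀ v ∈ I.bag t, x v = y v) : I.idx t x = I.idx t y :=
  binary_congr fun _ hl => h _ (elem_mem hl)

theorem eq_of_idx_eq (h : I.idx t x = I.idx t y) (hv : v ∈ I.bag t) : x v = y v := by
  obtain ⟨l, hl, rfl⟩ := exists_elem_eq hv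
  exact eq_of_binary_eq h l hl

theorem exists_idx_eq {a : ℕ} (ha : a < I.tableSize t) : ∃ x, I.idx t x = a := by
  refine ⟨fun v => a.testBit (Function.invFunOn (I.elem t) (Set.Iio (I.bag t).card) v), ?_⟩
  rw [idx, binary_congr (z := a.testBit), binary_testBit]
  · exact Nat.mod_eq_of_lt ha
  · exact fun l hl => congrArg _ ((I.bijOn_elem t).injOn.leftInvOn_invFunOn hl)

theorem above_above (t : ℕ) (x : ℕ → Bool) : I.above t (I.above t x) = I.above t x := by
  ext v
  simp [above]

theorem sepIdx_congr (h : ∀ v ∈ I.bag t, I.top v < t → x v = y v) : I.sepIdx t x = I.sepIdx t y :=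
  idx_congr fun v hv => by
    by_cases ht : I.top v < t
    · simp [above, ht, h v hv ht]
    · simp [above, ht]

theorem eq_of_sepIdx_eq (h : I.sepIdx t x = I.sepIdx t y) (hv : v ∈ I.bag t) (ht : I.top v < t) :
    x v = y v := by
  simpa [above, ht] using eq_of_idx_eq h hv

theorem start_succ (t : ℕ) : I.start (t + 1) = I.start t + 2 + (I.bag t).card := by
  rw [start, Finset.sum_range_succ, start]
  omega

theorem offset_succ (t : ℕ) : I.offset (t + 1) = I.offset t + I.tableSize t :=
  Finset.sum_range_succ _ _

theorem sepIdx_eq_of_idx_eq (h : I.idx t x = I.idx t y) : I.sepIdx t x = I.sepIdx t y :=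
  sepIdx_congr fun _ hv _ => eq_of_idx_eq h hv

theorem offset_add_tableSize_le (h : t < u) : I.offset t + I.tableSize t ≤ I.offset u := by
  rw [← offset_succ]
  exact Finset.sum_le_sum_of_subset (Finset.range_mono h)

theorem offset_add_inj {a b : ℕ} (ha : a < I.tableSize t) (hb : b < I.tableSize u) :
    I.offset t + a = I.offset u + b ↔ t = u ∧ a = b := by
  refine ⟨fun h => ?_, fun h => by rw [h.1, h.2]⟩
  rcases lt_trichotomy t u with htu | rfl | htu
  · have := I.offset_add_tableSize_le htu
    omega
  · exact ⟨rfl, by omega⟩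
  · have := I.offset_add_tableSize_le htu
    omega

/-! ### Dynamic programming over the tree -/

/-- For every assignment to the separator of `t` from its parent, `g` gives the index of an
extension to the bag of `t` which minimizes `f`. -/
structure IsBestExtension (I : RootedInstance) (t : ℕ) (f : ℕ → ℤ) (g : ℕ → ℕ) : Prop where
  exists_extension : ∀ x, ∃ y, I.sepIdx t y = I.sepIdx t x ∧ I.idx t y = g (I.sepIdx t x)
  le : ∀ x, f (g (I.sepIdx t x)) ≤ f (I.idx t x)

/-- The invariant of the elimination of the nodes `t, …, numNodes - 1`: `f u` is the table of the
node `u`, and `g u` assigns to every assignment to the separator of an eliminated node `u` an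
optimal extension to its bag. Up to a constant, the energy is the sum of the tables of the remaining
nodes and of the nonnegative losses incurred at the eliminated nodes. -/
structure Elimination (I : RootedInstance) (t : ℕ) (f : ℕ → ℕ → ℤ) (g : ℕ → ℕ → ℕ) : Prop where
  best : ∀ u < I.numNodes, t ≤ u → I.IsBestExtension u (f u) (g u)
  exists_energy_eq : ∃ c : ℤ, ∀ x, I.energy x = c + ∑ u ∈ Finset.range t, f u (I.idx u x) +
    ∑ u ∈ Finset.Ico t I.numNodes, (f u (I.idx u x) - f u (g u (I.sepIdx u x)))

theorem IsBestExtension.congr {f f' : ℕ → ℤ} {g g' : ℕ → ℕ} (h : I.IsBestExtension t f g)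
    (hf : ∀ x, f' (I.idx t x) = f (I.idx t x)) (hg : ∀ x, g' (I.sepIdx t x) = g (I.sepIdx t x)) :
    I.IsBestExtension t f' g' where
  exists_extension x := by simpa only [hg] using h.exists_extension x
  le x := by
    obtain ⟨y, -, hy⟩ := h.exists_extension x
    have := h.le x
    rwa [hg, ← hy, hf, hf, hy]

theorem IsBestExtension.apply_eq {f f' : ℕ → ℤ} {g g' : ℕ → ℕ} (h : I.IsBestExtension t f g)
    (hf : ∀ x, f' (I.idx t x) = f (I.idx t x)) (hg : ∀ x, g' (I.sepIdx t x) = g (I.sepIdx t x)) :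
    f' (g' (I.sepIdx t x)) = f (g (I.sepIdx t x)) := by
  obtain ⟨y, -, hy⟩ := h.exists_extension x
  rw [hg, ← hy, hf]

theorem IsBestExtension.lt {f : ℕ → ℤ} {g : ℕ → ℕ} (h : I.IsBestExtension t f g) (x : ℕ → Bool) :
    g (I.sepIdx t x) < I.tableSize t := by
  obtain ⟨y, -, hy⟩ := h.exists_extension x
  exact hy ▸ idx_lt t y

/-- The extensions given by `g` minimize `f` among those with an index below `k`. -/
structure IsBestExtensionBelow (I : RootedInstance) (t k : ℕ) (f : ℕ → ℤ) (g : ℕ → ℕ) : Prop where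
  exists_extension : ∀ x, ∃ y, I.sepIdx t y = I.sepIdx t x ∧ I.idx t y = g (I.sepIdx t x)
  le : ∀ x, I.idx t x < k → f (g (I.sepIdx t x)) ≤ f (I.idx t x)

namespace IsBestExtensionBelow

variable {k : ℕ} {f : ℕ → ℤ} {g : ℕ → ℕ}

theorem zero (I : RootedInstance) (t : ℕ) (f : ℕ → ℤ) : I.IsBestExtensionBelow t 0 f id where
  exists_extension x := ⟨I.above t x, by rw [sepIdx, above_above, sepIdx], rfl⟩
  le _ h := absurd h (Nat.not_lt_zero _)

theorem succ_of_lt (h : I.IsBestExtensionBelow t k f g) (hk : I.idx t x = k)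
    (hlt : f k < f (g (I.sepIdx t x))) :
    I.IsBestExtensionBelow t (k + 1) f (Function.update g (I.sepIdx t x) k) where
  exists_extension y := by
    rcases eq_or_ne (I.sepIdx t y) (I.sepIdx t x) with hy | hy
    · exact ⟨x, hy.symm, by rw [hy, Function.update_self, hk]⟩
    · rw [Function.update_of_ne hy]
      exact h.exists_extension y
  le y hyk := by
    rcases (Nat.lt_succ_iff.1 hyk).eq_or_lt with hyk | hyk
    · rw [sepIdx_eq_of_idx_eq (hyk.trans hk.symm), Function.update_self, hyk]
    · rcases eq_or_ne (I.sepIdx t y) (I.sepIdx t x) with hy | hy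
      · rw [hy, Function.update_self]
        exact hlt.le.trans (hy ▸ h.le y hyk)
      · rw [Function.update_of_ne hy]
        exact h.le y hyk

theorem succ_of_le (h : I.IsBestExtensionBelow t k f g) (hk : I.idx t x = k)
    (hle : f (g (I.sepIdx t x)) ≤ f k) : I.IsBestExtensionBelow t (k + 1) f g where
  exists_extension := h.exists_extension
  le y hyk := by
    rcases (Nat.lt_succ_iff.1 hyk).eq_or_lt with hyk | hyk
    · rwa [sepIdx_eq_of_idx_eq (hyk.trans hk.symm), hyk]
    · exact h.le y hyk

theorem isBestExtension (h : I.IsBestExtensionBelow t (I.tableSize t) f g) :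
    I.IsBestExtension t f g :=
  ⟨h.exists_extension, fun x => h.le x (idx_lt t x)⟩

end IsBestExtensionBelow

theorem energy_eq_sum_home (x : ℕ → Bool) : I.energy x = ∑ u ∈ Finset.range I.numNodes,
    ∑ q ∈ Finset.range I.numTerms, if u = I.home q then I.term q x else 0 := by
  rw [Finset.sum_comm]
  refine Finset.sum_congr rfl fun q hq => ?_
  rw [Finset.sum_ite_eq', if_pos (Finset.mem_range.2 (home_lt (Finset.mem_range.1 hq)))]

/-- The separator of the root is empty. -/
theorem exists_eq_const_add_sum_parent (I : RootedInstance) (t : ℕ) (φ : ℕ → ℤ) :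
    ∃ K : ℤ, ∀ x, φ (I.sepIdx t x) = K + ∑ u ∈ Finset.range t,
      if 0 < t ∧ u = I.parent t then φ (I.sepIdx t x) else 0 := by
  rcases t.eq_zero_or_pos with rfl | h0
  · refine ⟨φ (I.sepIdx 0 fun _ => false), fun x => ?_⟩
    rw [Finset.range_zero, Finset.sum_empty, add_zero, sepIdx_congr]
    simp
  · exact ⟨0, fun x => by simp [h0, I.parent_lt t h0]⟩

namespace Elimination

variable {f f' : ℕ → ℕ → ℤ} {g g' : ℕ → ℕ → ℕ}

theorem initial (h : ∀ u < I.numNodes, ∀ x, f u (I.idx u x) =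
    ∑ q ∈ Finset.range I.numTerms, if u = I.home q then I.term q x else 0) :
    I.Elimination I.numNodes f g where
  best u hu hu' := absurd hu hu'.not_gt
  exists_energy_eq := ⟨0, fun x => by
    rw [energy_eq_sum_home, Finset.Ico_self, Finset.sum_empty, zero_add, add_zero]
    exact Finset.sum_congr rfl fun u hu => (h u (Finset.mem_range.1 hu) x).symm⟩

/-- At the root the optimal value is a constant; below it, the optimal value depends only on the
separator and moves to the table of the parent. -/
theorem step (h : I.Elimination (t + 1) f g) (ht : t < I.numNodes)
    (hbest : I.IsBestExtension t (f t) (g' t))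
    (hg : ∀ u < I.numNodes, t < u → ∀ x, g' u (I.sepIdx u x) = g u (I.sepIdx u x))
    (hf : ∀ u < I.numNodes, ∀ x, f' u (I.idx u x) = f u (I.idx u x) +
      if 0 < t ∧ u = I.parent t then f t (g' t (I.sepIdx t x)) else 0) :
    I.Elimination t f' g' := by
  have hf' : ∀ u < I.numNodes, t ≤ u → ∀ x, f' u (I.idx u x) = f u (I.idx u x) := by
    intro u hu htu x
    rw [hf u hu, if_neg, add_zero]
    rintro ⟨h0, rfl⟩
    exact htu.not_gt (I.parent_lt t h0)
  obtain ⟨K, hK⟩ := I.exists_eq_const_add_sum_parent t fun a => f t (g' t a)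
  obtain ⟨c, hc⟩ := h.exists_energy_eq
  refine ⟨fun u hu htu => ?_, c + K, fun x => ?_⟩
  · rcases htu.eq_or_lt with rfl | htu'
    · exact hbest.congr (hf' t hu le_rfl) fun _ => rfl
    · exact (h.best u hu htu').congr (hf' u hu htu) (hg u hu htu')
  · have hremaining : ∑ u ∈ Finset.range t, f' u (I.idx u x) =
        ∑ u ∈ Finset.range t, f u (I.idx u x) + (f t (g' t (I.sepIdx t x)) - K) := by
      rw [hK x, add_sub_cancel_left, ← Finset.sum_add_distrib]
      exact Finset.sum_congr rfl fun u hu => hf u ((Finset.mem_range.1 hu).trans ht) x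
    have heliminated : ∑ u ∈ Finset.Ico (t + 1) I.numNodes,
        (f' u (I.idx u x) - f' u (g' u (I.sepIdx u x))) =
        ∑ u ∈ Finset.Ico (t + 1) I.numNodes, (f u (I.idx u x) - f u (g u (I.sepIdx u x))) := by
      refine Finset.sum_congr rfl fun u hu => ?_
      rw [Finset.mem_Ico] at hu
      rw [hf' u hu.2 (Nat.le_of_succ_le hu.1),
        (h.best u hu.2 hu.1).apply_eq (hf' u hu.2 (Nat.le_of_succ_le hu.1)) (hg u hu.2 hu.1)]
    rw [hc, Finset.sum_range_succ, hremaining, Finset.sum_eq_sum_Ico_succ_bot ht, heliminated,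
      hf' t ht le_rfl, hbest.apply_eq (hf' t ht le_rfl) fun _ => rfl]
    ring

/-- The losses are nonnegative, and they all vanish at `x`. -/
theorem energy_le (h : I.Elimination 0 f g)
    (hx : ∀ u < I.numNodes, I.idx u x = g u (I.sepIdx u x)) (y : ℕ → Bool) :
    I.energy x ≤ I.energy y := by
  obtain ⟨c, hc⟩ := h.exists_energy_eq
  rw [hc, hc, Finset.range_zero, Finset.sum_empty, Finset.sum_empty, ← Finset.range_eq_Ico]
  refine add_le_add_right (Finset.sum_le_sum fun u hu => ?_) _
  have hu := Finset.mem_range.1 hu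
  rw [← hx u hu, sub_self, sub_nonneg]
  exact (h.best u hu u.zero_le).le y

end Elimination

/-- The partial solution `x` is optimal on the bags of the nodes before `t`, and `false` on all
other variables. -/
structure Decoded (I : RootedInstance) (g : ℕ → ℕ → ℕ) (t : ℕ) (x : ℕ → Bool) : Prop where
  idx_eq : ∀ u < t, I.idx u x = g u (I.sepIdx u x)
  eq_false : ∀ v, t ≤ I.top v → x v = false

theorem Decoded.sepIdx_eq {g : ℕ → ℕ → ℕ} (h : I.Decoded g t x) : I.sepIdx t x = I.idx t x :=
  idx_congr fun v _ => by
    by_cases ht : I.top v < t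
    · simp [above, ht]
    · simp [above, h.eq_false v (not_lt.1 ht)]

theorem Decoded.step {g : ℕ → ℕ → ℕ} (h : I.Decoded g t x) {f : ℕ → ℤ}
    (hbest : I.IsBestExtension t f (g t)) (hidx : I.idx t y = g t (I.idx t x))
    (hy : ∀ v, v ∉ I.bag t → y v = x v) : I.Decoded g (t + 1) y := by
  obtain ⟨z, hzsep, hz⟩ := hbest.exists_extension x
  rw [h.sepIdx_eq, ← hidx] at hz
  have hsep : ∀ v, I.top v < t → y v = x v := fun v hvt => by
    by_cases hv : v ∈ I.bag t
    · rw [← eq_of_idx_eq hz hv, eq_of_sepIdx_eq hzsep hv hvt]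
    · exact hy v hv
  refine ⟨fun u hu => ?_, fun v hv => ?_⟩
  · rcases (Nat.lt_succ_iff.1 hu).eq_or_lt with rfl | hu
    · rw [hidx, sepIdx_congr fun v _ hv => hsep v hv, h.sepIdx_eq]
    · rw [idx_congr fun v hv => hsep v ((top_le hv).trans_lt hu),
        sepIdx_congr fun v hv _ => hsep v ((top_le hv).trans_lt hu), h.idx_eq u hu]
  · rw [hy v fun hv' => (top_le hv').not_gt hv, h.eq_false v (Nat.le_of_succ_le hv)]

end RootedInstance

/-! ### The algorithm -/

namespace Exp

/-- The number of variables of the Hamiltonian. -/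
def numVars : Exp := get .input 0

/-- The number of terms of the Hamiltonian. -/
def numTerms : Exp := get .input 1

/-- The number of nodes of the tree decomposition. -/
def numNodes : Exp := get .input (2 + (numTerms + numTerms + numTerms))

/-- The first variable of the term `q`. -/
def left : Exp := get .input (2 + (var .q + var .q + var .q))

/-- The second variable of the term `q`. -/
def right : Exp := get .input (3 + (var .q + var .q + var .q))

/-- The weight of the term `q`. -/
def weight : Exp := get .input (4 + (var .q + var .q + var .q))

/-- The parent of the node `x`. -/
def parent (x : Var) : Exp := get .input (get .start (var x))

/-- The size of the bag of the node `x`. -/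
def bagSize (x : Var) : Exp := get .input (get .start (var x) + 1)

/-- The element number `y` of the bag of the node `x`. -/
def elem (x y : Var) : Exp := get .input (get .start (var x) + 2 + var y)

/-- The number of entries of the table of the node `x`. -/
def tableSize (x : Var) : Exp := get .pow (bagSize x)

/-- The position of the entry `e` of the table of the node `x`. -/
def cell (x : Var) (e : Exp) : Exp := get .offset (var x) + e

/-- The best extension stored for the assignment to the separator of the node `t` which the subset
`a` of its bag induces. -/
def choice : Exp := get .choice (cell .t (get .sum (var .a)))

end Exp

namespace Cmd

open Exp (var get numVars numTerms numNodes left right weight parent bagSize elem tableSize cell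
  choice)

/-- Compute the powers of two. -/
def computePowers : Cmd :=
  put .pow 0 1 ;;
  loop .j numVars (put .pow (var .j + 1) (get .pow (var .j) + get .pow (var .j)))

/-- Set the topmost node of those elements of the bag of `t` which have none. Nodes are stored in
`top` with an offset of one, as zero means that there is none. -/
def recordTops : Cmd :=
  loop .i (bagSize .t)
    (ifLt (get .top (elem .t .i)) 1 (put .top (elem .t .i) (var .t + 1)) skip)

/-- Read the description of the node `t`, which begins at `pos`. -/
def readNode : Cmd :=
  put .start (var .t) (var .pos) ;;
  put .offset (var .t) (var .cells) ;;
  recordTops ;;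
  set .pos (var .pos + 2 + bagSize .t) ;;
  set .cells (var .cells + tableSize .t)

/-- Compute the arrays `start`, `offset` and `top`. -/
def readNodes : Cmd :=
  set .pos (3 + (numTerms + numTerms + numTerms)) ;;
  set .cells 0 ;;
  loop .t numNodes readNode

/-- Extend the sums of the marks from the subsets of the first `i` elements of the bag of `node` to
the subsets of the first `i + 1` elements. -/
def extendSums : Cmd :=
  loop .a (get .pow (var .i))
    (put .sum (get .pow (var .i) + var .a) (get .sum (var .a) + get .mark (elem .node .i)))

/-- Compute, for every subset of the bag of `node`, the sum of the marks of its elements. -/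
def subsetSums : Cmd :=
  put .sum 0 0 ;; loop .i (bagSize .node) extendSums

/-- Find the node whose table receives the term `q`. -/
def findHome : Cmd :=
  ifLt (get .top left) (get .top right) (set .node (get .top right - 1))
    (set .node (get .top left - 1))

/-- Add the weight of the term `q` to the table of `node` wherever the sum of the marks exceeds
one. -/
def addWeight : Cmd :=
  loop .a (tableSize .node)
    (ifLt 1 (get .sum (var .a))
      (put .table (cell .node (var .a)) (get .table (cell .node (var .a)) + weight)) skip)

/-- Mark the variables of the term `q`; if they coincide, the variable receives two marks. -/
def markTerm : Cmd :=
  put .mark left (get .mark left + 1) ;; put .mark right (get .mark right + 1)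

/-- Remove the marks from the variables of the term `q`. -/
def unmarkTerm : Cmd := put .mark left 0 ;; put .mark right 0

/-- Add the term `q` to a table. -/
def addTerm : Cmd := findHome ;; markTerm ;; subsetSums ;; addWeight ;; unmarkTerm

/-- Mark the elements of the separator of `t` such that the subset sums are the indices of the
restrictions to the separator. -/
def markSeparator : Cmd :=
  loop .i (bagSize .t)
    (ifLt (get .top (elem .t .i)) (var .t + 1)
      (put .mark (elem .t .i) (get .mark (elem .t .i) + get .pow (var .i))) skip)

/-- Let every separator assignment at `t` be extended by `false`, that is, with the same index. -/
def resetChoice : Cmd :=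
  loop .a (tableSize .t) (put .choice (cell .t (var .a)) (var .a))

/-- Go through the assignments to the bag of `t` and record those that are better than the choice
which has been made for their restriction to the separator. -/
def improveChoice : Cmd :=
  loop .a (tableSize .t)
    (ifLt (get .table (cell .t (var .a))) (get .table (cell .t choice))
      (put .choice (cell .t (get .sum (var .a))) (var .a)) skip)

/-- Compute the best extensions of the assignments to the separator of `t`. -/
def chooseExtensions : Cmd :=
  markSeparator ;; set .node (var .t) ;; subsetSums ;; resetChoice ;; improveChoice

/-- Add the optimal values for the separator of `t` to the table of its parent `node`. -/
def push : Cmd :=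
  loop .a (tableSize .node)
    (put .table (cell .node (var .a))
      (get .table (cell .node (var .a)) + get .table (cell .t choice)))

/-- Add the optimal values for the separator of `t` to the table of its parent, if there is one. -/
def pushToParent : Cmd :=
  ifLt 0 (var .t) (set .node (parent .t) ;; subsetSums ;; push) skip

/-- Remove the marks from the bag of `t`. -/
def unmark : Cmd :=
  loop .i (bagSize .t) (put .mark (elem .t .i) 0)

/-- Handle the node `t` in the pass from the leaves to the root. -/
def eliminateNode : Cmd := chooseExtensions ;; pushToParent ;; unmark

/-- Compute the best extensions at all nodes. -/
def eliminate : Cmd :=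
  loop .r numNodes (set .t (numNodes - (var .r + 1)) ;; eliminateNode)

/-- Compute in `key` the index of the restriction of `sol` to the bag of `t`. -/
def computeKey : Cmd :=
  set .key 0 ;;
  loop .i (bagSize .t)
    (ifLt 0 (get .sol (elem .t .i)) (set .key (var .key + get .pow (var .i))) skip)

/-- Assign the leading one of `j + 1` binary digits of `best` to the element number `j` of the bag
of `t`, and remove it. -/
def assignDigit : Cmd :=
  ifLt (var .best) (get .pow (var .j)) (put .sol (elem .t .j) 0)
    (put .sol (elem .t .j) 1 ;; set .best (var .best - get .pow (var .j)))

/-- Assign the binary digits of `best` to the elements of the bag of `t`. -/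
def assignDigits : Cmd :=
  loop .i (bagSize .t) (set .j (bagSize .t - (var .i + 1)) ;; assignDigit)

/-- Extend the solution to the bag of `t`. -/
def decodeNode : Cmd :=
  computeKey ;;
  set .best (get .choice (cell .t (var .key))) ;;
  assignDigits

/-- Compute a solution in the pass from the root to the leaves. -/
def decode : Cmd := loop .t numNodes decodeNode

/-- Copy the solution to the beginning of the memory. -/
def output : Cmd := loop .j numVars (put .input (var .j) (get .sol (var .j)))

/-- The algorithm. -/
def solve : Cmd :=
  computePowers ;; readNodes ;; loop .q numTerms addTerm ;; eliminate ;; decode ;; output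

end Cmd

/-! ### The preprocessed input -/

namespace RootedInstance

/-- The instance `I` is encoded in the array `inp`. -/
structure Encodes (I : RootedInstance) (inp : ℕ → ℤ) : Prop where
  numVars : inp 0 = I.numVars
  numTerms : inp 1 = I.numTerms
  left : ∀ q < I.numTerms, inp (2 + 3 * q) = I.left q
  right : ∀ q < I.numTerms, inp (3 + 3 * q) = I.right q
  weight : ∀ q < I.numTerms, inp (4 + 3 * q) = I.weight q
  numNodes : inp (2 + 3 * I.numTerms) = I.numNodes
  parent : ∀ t < I.numNodes, 0 < t → inp (I.start t) = I.parent t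
  card_bag : ∀ t < I.numNodes, inp (I.start t + 1) = (I.bag t).card
  elem : ∀ t < I.numNodes, ∀ l < (I.bag t).card, inp (I.start t + 2 + l) = I.elem t l

/-- The data which give access to the node `t` are in place. -/
structure Located (I : RootedInstance) (t : ℕ) (arr : Arr → ℕ → ℤ) : Prop where
  lt : t < I.numNodes
  encodes : I.Encodes (arr .input)
  pow : ∀ l ≤ I.numVars, arr .pow l = (2 ^ l : ℕ)
  start : arr .start t = I.start t
  offset : arr .offset t = I.offset t

/-- The results of the preprocessing phase are in place. -/
structure Preprocessed (I : RootedInstance) (arr : Arr → ℕ → ℤ) : Prop where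
  encodes : I.Encodes (arr .input)
  located : ∀ t < I.numNodes, I.Located t arr
  top : ∀ v < I.numVars, arr .top v = I.top v + 1

variable {I : RootedInstance} {t : ℕ} {c : Cmd} {s s' : Store}

theorem Located.frame (h : I.Located t s.arr) (hf : Cmd.Frame c s s')
    (hc : .input ∉ c.modified ∧ .pow ∉ c.modified ∧ .start ∉ c.modified ∧ .offset ∉ c.modified :=
      by decide) : I.Located t s'.arr := by
  obtain ⟨lt, encodes, pow, start, offset⟩ := h
  constructor <;> simpa only [hf.arr _ hc.1, hf.arr _ hc.2.1, hf.arr _ hc.2.2.1, hf.arr _ hc.2.2.2]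

theorem Preprocessed.frame (h : I.Preprocessed s.arr) (hf : Cmd.Frame c s s')
    (hc : .input ∉ c.modified ∧ .pow ∉ c.modified ∧ .start ∉ c.modified ∧ .offset ∉ c.modified :=
      by decide) (htop : .top ∉ c.modified := by decide) : I.Preprocessed s'.arr where
  encodes := by simpa only [hf.arr _ hc.1] using h.encodes
  located t ht := (h.located t ht).frame hf hc
  top := by simpa only [hf.arr _ htop] using h.top

end RootedInstance

namespace Exp

variable {I : RootedInstance} {s : Store} {x y : Var} {e : Exp} {t a : ℕ}

theorem toNat_add_triple (k n : ℕ) : ((k : ℤ) + ((n : ℤ) + n + n)).toNat = k + 3 * n := by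
  omega

section Encodes

variable (h : I.Encodes (s.arr .input))
include h

theorem eval_numVars : numVars.eval s = I.numVars := h.numVars

theorem eval_numTerms : numTerms.eval s = I.numTerms := h.numTerms

theorem eval_numNodes : numNodes.eval s = I.numNodes := by
  rw [← h.numNodes, numNodes, eval_get, eval_add, eval_add, eval_add, eval_numTerms h, eval_ofNat,
    toNat_add_triple]

variable (hq : s.var .q < I.numTerms)
include hq

theorem eval_left : left.eval s = I.left (s.var .q) := by
  rw [← h.left _ hq]
  exact congrArg _ (toNat_add_triple _ _)

theorem eval_right : right.eval s = I.right (s.var .q) := by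
  rw [← h.right _ hq]
  exact congrArg _ (toNat_add_triple _ _)

theorem eval_weight : weight.eval s = I.weight (s.var .q) := by
  rw [← h.weight _ hq]
  exact congrArg _ (toNat_add_triple _ _)

end Encodes

section Located

variable (h : I.Located t s.arr) (hx : s.var x = t)
include h hx

theorem eval_parent (ht : 0 < t) : (parent x).eval s = I.parent t := by
  rw [← h.encodes.parent t h.lt ht, parent, eval_get, eval_get, eval_var, hx, Int.toNat_natCast,
    h.start, Int.toNat_natCast]

theorem eval_bagSize : (bagSize x).eval s = (I.bag t).card := by
  rw [← h.encodes.card_bag t h.lt, bagSize, eval_get, eval_add, eval_get, eval_var, hx,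
    Int.toNat_natCast, h.start, eval_ofNat, ← Nat.cast_add, Int.toNat_natCast]

theorem eval_elem (hy : s.var y < (I.bag t).card) : (elem x y).eval s = I.elem t (s.var y) := by
  rw [← h.encodes.elem t h.lt _ hy, elem, eval_get, eval_add, eval_add, eval_get, eval_var,
    eval_var, hx, Int.toNat_natCast, h.start, eval_ofNat, ← Nat.cast_add, ← Nat.cast_add,
    Int.toNat_natCast]

theorem eval_tableSize : (tableSize x).eval s = I.tableSize t := by
  rw [tableSize, eval_get, eval_bagSize h hx, Int.toNat_natCast,
    h.pow _ (RootedInstance.card_bag_le _), RootedInstance.tableSize]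

theorem eval_cell (he : e.eval s = a) : (cell x e).eval s = (I.offset t + a : ℕ) := by
  rw [cell, eval_add, eval_get, eval_var, hx, Int.toNat_natCast, h.offset, he, Nat.cast_add]

end Located

end Exp

/-! ### Subset sums -/

namespace Cmd

open Exp (var get eval_bagSize eval_elem eval_tableSize eval_cell)

variable {I : RootedInstance} {s : Store} {t : ℕ}

theorem extendSums_spec (h : I.Located t s.arr) (ht : s.var .node = t)
    (hi : s.var .i < (I.bag t).card) :
    Ensures extendSums s (1 + 2 ^ s.var .i * (1 + 1)) fun s' => ∀ a < 2 ^ s.var .i,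
      s'.arr .sum a = s.arr .sum a ∧
      s'.arr .sum (2 ^ s.var .i + a) = s.arr .sum a + s.arr .mark (I.elem t (s.var .i)) := by
  set l := s.var .i
  have hpow {s' : Store} (h' : I.Located t s'.arr) (hi' : s'.var .i = l) :
      (get .pow (var .i)).eval s' = (2 ^ l : ℕ) := by
    simpa [hi'] using h'.pow l (hi.le.trans (RootedInstance.card_bag_le t))
  refine (Ensures.loop_const (hpow h rfl) (fun k s' => ∀ a < 2 ^ l, s'.arr .sum a = s.arr .sum a ∧
    (a < k → s'.arr .sum (2 ^ l + a) = s.arr .sum a + s.arr .mark (I.elem t l))) (by simp)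
    fun k hk s' hs' ha hInv => .put ?_).mono le_rfl
      fun s' _ hs' a ha => ⟨(hs' a ha).1, (hs' a ha).2 ha⟩
  have hloc : I.Located t s'.arr := h.frame hs'
  have hi' : s'.var .i = l := hs'.var .i (by decide)
  have helem := eval_elem (y := .i) hloc ((hs'.var .node (by decide)).trans ht) (by rwa [hi'])
  rw [Exp.eval_add, hpow hloc hi', Exp.eval_add, Exp.eval_get, Exp.eval_get, helem, Exp.eval_var,
    ha, hi', hs'.arr .mark (by decide), ← Nat.cast_add, Int.toNat_natCast, Int.toNat_natCast,
    Int.toNat_natCast, (hInv k hk).1, Store.setArr_arr_self]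
  refine fun a ha => ⟨?_, fun hak => ?_⟩
  · rw [Function.update_of_ne (by omega), (hInv a ha).1]
  · rcases (Nat.lt_succ_iff.1 hak).eq_or_lt with rfl | hak
    · rw [Function.update_self]
    · rw [Function.update_of_ne (by omega), (hInv a ha).2 hak]

theorem subsetSums_spec (h : I.Located t s.arr) (ht : s.var .node = t) :
    Ensures subsetSums s (4 * I.tableSize t) fun s' => ∀ x, s'.arr .sum (I.idx t x) =
      ∑ v ∈ I.bag t, if x v then s.arr .mark v else 0 := by
  refine Ensures.mono (.seq (.put (Q := fun s₁ => s₁.arr .sum 0 = 0) (by simp))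
    fun s₁ hs₁ h₀ => .loop (eval_bagSize (h.frame hs₁) ((hs₁.var .node (by decide)).trans ht))
      (fun l => 1 + 2 ^ l * (1 + 1)) (fun l s' => ∀ x : ℕ → Bool,
        s'.arr .sum (binary l fun k => x (I.elem t k)) =
          ∑ k ∈ Finset.range l, if x (I.elem t k) then s.arr .mark (I.elem t k) else 0)
      (by simp [binary, h₀]) fun l hl s' hs' hi hInv => ?_) ?_
    fun s' _ hs' x => (hs' x).trans
      (RootedInstance.sum_elem t fun v => if x v then s.arr .mark v else 0)
  · subst hi
    refine (extendSums_spec ((h.frame hs₁).frame hs') ((hs'.var .node (by decide)).trans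
      ((hs₁.var .node (by decide)).trans ht)) hl).mono le_rfl fun s'' _ hsum x => ?_
    obtain ⟨hsmall, hlarge⟩ := hsum _ (binary_lt _ fun k => x (I.elem t k))
    rw [hs'.arr .mark (by decide), hs₁.arr .mark (by decide)] at hlarge
    rw [binary_succ, Finset.sum_range_succ, ← hInv]
    cases x (I.elem t (s'.var .i)) with
    | false => simpa using hsmall
    | true => simpa [add_comm] using hlarge
  · have hcard := Nat.lt_two_pow_self (n := (I.bag t).card)
    have hsum : ∑ l ∈ Finset.range (I.bag t).card, 2 ^ l + 1 = 2 ^ (I.bag t).card := by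
      rw [Nat.geomSum_eq le_rfl]
      omega
    simp only [RootedInstance.tableSize, Finset.sum_add_distrib, ← Finset.sum_mul, Finset.sum_const,
      Finset.card_range, smul_eq_mul]
    omega

end Cmd

/-! ### Preprocessing -/

namespace Cmd

open Exp (var get numNodes eval_numVars eval_numTerms eval_numNodes eval_bagSize eval_elem
  eval_tableSize eval_cell)

variable {I : RootedInstance} {s : Store} {t : ℕ}

theorem computePowers_spec (h : I.Encodes (s.arr .input)) :
    Ensures computePowers s (2 + 2 * I.numVars) fun s' =>
      ∀ l ≤ I.numVars, s'.arr .pow l = (2 ^ l : ℕ) := by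
  refine Ensures.mono (.seq (.put (Q := fun s₁ => s₁.arr .pow 0 = 1) (by simp)) fun s₁ hs₁ h₀ =>
    .loop_const (eval_numVars (by rwa [hs₁.arr .input (by decide)]))
      (fun k s' => ∀ l ≤ k, s'.arr .pow l = (2 ^ l : ℕ)) (by simpa using h₀)
      fun k _ s' _ hj hInv => .put fun l hl => ?_) (by omega) fun _ _ hs' => hs'
  have hindex : ((var .j + 1).eval s').toNat = k + 1 := by simp [hj]
  rw [hindex, Store.setArr_arr_self]
  rcases hl.eq_or_lt with rfl | hl
  · simp [hj, hInv k le_rfl, pow_succ, mul_two]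
  · rw [Function.update_of_ne hl.ne, hInv l (Nat.lt_succ_iff.1 hl)]

theorem recordTops_spec (h : I.Located t s.arr) (ht : s.var .t = t) :
    Ensures recordTops s (1 + 3 * (I.bag t).card) fun s' => ∀ v, s'.arr .top v =
      if v ∈ I.bag t ∧ s.arr .top v < 1 then (t : ℤ) + 1 else s.arr .top v := by
  refine (Ensures.loop_const (B := 2) (eval_bagSize h ht) (fun k s' => ∀ v, s'.arr .top v =
      if (∃ l < k, I.elem t l = v) ∧ s.arr .top v < 1 then (t : ℤ) + 1 else s.arr .top v) (by simp)
    fun k hk s' hs' hi hInv => ?_).mono (by omega) fun s' _ hs' v => ?_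
  · have ht' := (hs'.var .t (by decide)).trans ht
    have helem := eval_elem (y := .i) (h.frame hs') ht' (by rwa [hi])
    rw [hi] at helem
    have hInv' := hInv (I.elem t k)
    refine .ifLt (fun hlt => .put fun v => ?_) fun hle => .skip fun v => ?_
    all_goals
      simp only [Exp.eval_get, helem, Exp.eval_ofNat, Exp.eval_add, Exp.eval_var, ht',
        Int.toNat_natCast, Nat.cast_one, Nat.exists_lt_succ_right, Store.setArr_arr_self] at *
      obtain rfl | hv := eq_or_ne (I.elem t k) v
    · rw [Function.update_self, if_pos]
      grind
    · rw [Function.update_of_ne hv.symm, hInv]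
      simp only [hv, or_false]
    · rw [hInv'] at hle ⊢
      by_cases hlt : s.arr .top (I.elem t k) < 1
      · have hk : ∃ l < k, I.elem t l = I.elem t k := by_contra fun h => by
          rw [if_neg fun h' => h h'.1] at hle
          omega
        rw [if_pos ⟨hk, hlt⟩, if_pos ⟨.inr rfl, hlt⟩]
      · rw [if_neg fun h => hlt h.2, if_neg fun h => hlt h.2]
    · rw [hInv]
      simp only [hv, or_false]
  · rw [hs']
    simp only [RootedInstance.mem_bag_iff]

theorem readNode_spec (he : I.Encodes (s.arr .input))
    (hpow : ∀ l ≤ I.numVars, s.arr .pow l = (2 ^ l : ℕ)) (hlt : t < I.numNodes)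
    (ht : s.var .t = t) (hpos : s.var .pos = I.start t) (hcells : s.var .cells = I.offset t) :
    Ensures readNode s (5 + 3 * (I.bag t).card) fun s' =>
      s'.var .pos = I.start (t + 1) ∧ s'.var .cells = I.offset (t + 1) ∧
      s'.arr .start = Function.update (s.arr .start) t (I.start t) ∧
      s'.arr .offset = Function.update (s.arr .offset) t (I.offset t) ∧
      ∀ v, s'.arr .top v =
        if v ∈ I.bag t ∧ s.arr .top v < 1 then (t : ℤ) + 1 else s.arr .top v := by
  refine Ensures.mono (.seq (.put (Q := fun s' =>
      s'.arr .start = Function.update (s.arr .start) t (I.start t)) (by simp [ht, hpos]))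
    fun s₁ hs₁ hstart => .seq (.put (Q := fun s' =>
      s'.arr .offset = Function.update (s.arr .offset) t (I.offset t)) ?_)
    fun s₂ hs₂ hoffset => ?_) (B := 1 + (1 + (1 + 3 * (I.bag t).card + (1 + 1)))) (by omega)
    fun _ _ h => h
  · simp [hs₁.arr .offset (by decide), hs₁.var .t (by decide), hs₁.var .cells (by decide), ht,
      hcells]
  have hvar : s₂.var = s.var := funext fun x => (hs₂.var x (by simp [assigned])).trans
    (hs₁.var x (by simp [assigned]))
  have hstart₂ := (hs₂.arr .start (by decide)).trans hstart
  have hloc : I.Located t s₂.arr := by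
    constructor
    · exact hlt
    · rwa [hs₂.arr .input (by decide), hs₁.arr .input (by decide)]
    · rwa [hs₂.arr .pow (by decide), hs₁.arr .pow (by decide)]
    · rw [hstart₂, Function.update_self]
    · rw [hoffset, Function.update_self]
  refine .seq (recordTops_spec hloc (by rw [hvar, ht])) fun s₃ hs₃ htop => .seq
    (.set (Q := fun s' => s'.var .pos = I.start (t + 1)) ?_) fun s₄ hs₄ hpos' => .set ?_
  · have := eval_bagSize (x := .t) (hloc.frame hs₃) (by rw [hs₃.var _ (by decide), hvar, ht])
    rw [Store.setVar_var_self, Exp.eval_add, Exp.eval_add, Exp.eval_var, this, Exp.eval_ofNat,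
      hs₃.var .pos (by decide), hvar, hpos, RootedInstance.start_succ,
      ← Nat.cast_add, ← Nat.cast_add, Int.toNat_natCast]
  · have := eval_tableSize (x := .t) ((hloc.frame hs₃).frame hs₄)
      (by rw [hs₄.var _ (by decide), hs₃.var _ (by decide), hvar, ht])
    refine ⟨hpos', ?_, ?_, ?_, fun v => ?_⟩
    · rw [Store.setVar_var_self, Exp.eval_add, Exp.eval_var, this, hs₄.var .cells (by decide),
        hs₃.var .cells (by decide), hvar, hcells, RootedInstance.offset_succ,
        ← Nat.cast_add, Int.toNat_natCast]
    · rw [Store.setVar_arr, hs₄.arr .start (by decide), hs₃.arr .start (by decide), hstart₂]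
    · rw [Store.setVar_arr, hs₄.arr .offset (by decide), hs₃.arr .offset (by decide), hoffset]
    · rw [Store.setVar_arr, hs₄.arr .top (by decide), htop, hs₂.arr .top (by decide),
        hs₁.arr .top (by decide)]

theorem readNodes_spec (he : I.Encodes (s.arr .input))
    (hpow : ∀ l ≤ I.numVars, s.arr .pow l = (2 ^ l : ℕ)) (htop : ∀ v, s.arr .top v = 0) :
    Ensures readNodes s (3 + ∑ t ∈ Finset.range I.numNodes, (6 + 3 * (I.bag t).card))
      fun s' => I.Preprocessed s'.arr := by
  refine Ensures.mono (.seq (.set (Q := fun s' => s'.var .pos = I.start 0) ?_)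
    fun s₁ hs₁ hpos => .seq (.set (Q := fun s' => s'.var .cells = I.offset 0) (by
      simp [RootedInstance.offset])) fun s₂ hs₂ hcells => .loop (eval_numNodes (I := I) ?_)
    (fun t => 5 + 3 * (I.bag t).card) (fun t s' => s'.var .pos = I.start t ∧
      s'.var .cells = I.offset t ∧
      (∀ u < t, s'.arr .start u = I.start u ∧ s'.arr .offset u = I.offset u) ∧
      ∀ v, s'.arr .top v = if ∃ u < t, v ∈ I.bag u then (I.top v : ℤ) + 1 else 0) ?_
    fun t ht s' hs' ht' hInv => ?_) ?_ fun s' hs' hInv => ?_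
  · simp [eval_numTerms he, RootedInstance.start]
    omega
  · rwa [hs₂.arr .input (by decide), hs₁.arr .input (by decide)]
  · exact ⟨(hs₂.var .pos (by decide)).trans hpos, hcells, by simp, fun v => by
      simp [hs₂.arr .top (by decide), hs₁.arr .top (by decide), htop]⟩
  · have hframe {A : Arr} (hA : A ∉ (loop .t numNodes readNode).modified) : s'.arr A = s.arr A :=
      (hs'.arr A hA).trans ((hs₂.arr A (by simp [modified])).trans (hs₁.arr A (by simp [modified])))
    obtain ⟨hpos', hcells', hread, htop'⟩ := hInv
    refine (readNode_spec (by rwa [hframe (by decide)]) (by rwa [hframe (by decide)]) ht ht' hpos'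
      hcells').mono le_rfl fun s'' _ ⟨hpos'', hcells'', hstart, hoffset, htop''⟩ =>
        ⟨hpos'', hcells'', fun u hu => ?_, fun v => ?_⟩
    · rcases (Nat.lt_succ_iff.1 hu).eq_or_lt with rfl | hu
      · rw [hstart, hoffset, Function.update_self, Function.update_self]
        exact ⟨rfl, rfl⟩
      · rw [hstart, hoffset, Function.update_of_ne hu.ne, Function.update_of_ne hu.ne]
        exact hread u hu
    · rw [htop'', htop']
      simp only [Nat.exists_lt_succ_right]
      by_cases hu : ∃ u < t, v ∈ I.bag u
      · rw [if_pos hu, if_neg (by omega), if_pos (.inl hu)]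
      · by_cases hv : v ∈ I.bag t
        · rw [if_neg hu, if_pos ⟨hv, one_pos⟩, if_pos (.inr hv),
            RootedInstance.top_eq hv fun u hlt h => hu ⟨u, hlt, h⟩]
        · rw [if_neg fun h => hv h.1, if_neg hu, if_neg (not_or.2 ⟨hu, hv⟩)]
  · simp only [Finset.sum_add_distrib, Finset.sum_const, Finset.card_range, smul_eq_mul]
    omega
  · obtain ⟨-, -, hread, htop'⟩ := hInv
    have he' : I.Encodes (s'.arr .input) := by rwa [hs'.arr .input (by decide)]
    refine ⟨he', fun t ht => ⟨ht, he', ?_, (hread t ht).1, (hread t ht).2⟩, fun v hv => ?_⟩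
    · rwa [hs'.arr .pow (by decide)]
    · obtain ⟨t, ht⟩ := I.exists_mem v hv
      rw [htop', if_pos ⟨t, I.node_lt_of_mem t v ht, ht⟩]

end Cmd

/-! ### Tables -/

namespace RootedInstance

variable {I : RootedInstance} {t u a b : ℕ}

/-- The part of an array of consecutive tables which belongs to the node `t`. -/
def entries (I : RootedInstance) (t : ℕ) (A : ℕ → ℤ) (a : ℕ) : ℤ := A (I.offset t + a)

theorem entries_update (ha : a < I.tableSize t) (hb : b < I.tableSize u) (A : ℕ → ℤ) (z : ℤ) :
    I.entries u (Function.update A (I.offset t + a) z) b =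
      if u = t ∧ b = a then z else I.entries u A b := by
  simp only [entries, Function.update_apply, offset_add_inj hb ha]

/-- The sum counts the factors of the term that are `1`. -/
theorem term_eq {q : ℕ} (hq : q < I.numTerms) (x : ℕ → Bool) : I.term q x =
    if 1 < ∑ v ∈ I.bag (I.home q), (if x v then
      (if v = I.left q then 1 else 0) + if v = I.right q then 1 else 0 else 0 : ℤ)
    then I.weight q else 0 := by
  rw [← Finset.sum_filter, Finset.sum_add_distrib, Finset.sum_ite_eq', Finset.sum_ite_eq', term]
  simp only [Finset.mem_filter, left_mem_home hq, right_mem_home hq, true_and]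
  cases x (I.left q) <;> cases x (I.right q) <;> simp

end RootedInstance

namespace Cmd

open Exp (var get numTerms left right weight tableSize cell eval_numTerms eval_left eval_right
  eval_weight eval_tableSize eval_cell)

variable {I : RootedInstance} {s : Store} {t : ℕ}

theorem addToTable_spec {p : Cmd} {B : ℕ} {φ : ℕ → ℤ} (h : I.Located t s.arr)
    (ht : s.var .node = t)
    (hp : ∀ a < I.tableSize t, ∀ s', Frame (.loop .a (tableSize .node) p) s s' → s'.var .a = a →
      (∀ u ≠ t, ∀ b < I.tableSize u,
        I.entries u (s'.arr .table) b = I.entries u (s.arr .table) b) →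
      Ensures p s' B fun s'' => s''.arr .table = Function.update (s'.arr .table) (I.offset t + a)
        (s'.arr .table (I.offset t + a) + φ a)) :
    Ensures (.loop .a (tableSize .node) p) s (1 + I.tableSize t * (1 + B)) fun s' =>
      ∀ u, ∀ b < I.tableSize u, I.entries u (s'.arr .table) b =
        I.entries u (s.arr .table) b + if u = t then φ b else 0 := by
  refine (Ensures.loop_const (eval_tableSize h ht) (fun a s' => ∀ u, ∀ b < I.tableSize u,
    I.entries u (s'.arr .table) b = I.entries u (s.arr .table) b +
      if u = t ∧ b < a then φ b else 0) (by simp) fun a ha s' hs' hsa hInv =>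
      (hp a ha s' hs' hsa fun u hu b hb => by simp [hInv u b hb, hu]).mono le_rfl
        fun s'' _ htable u b hb => ?_).mono le_rfl fun s' _ hs' u b hb => ?_
  · rw [htable, RootedInstance.entries_update ha hb]
    have := hInv u b hb
    by_cases hub : u = t ∧ b = a
    · rw [if_pos hub, if_pos ⟨hub.1, by omega⟩]
      obtain ⟨rfl, rfl⟩ := hub
      simpa [RootedInstance.entries] using this
    · rw [if_neg hub, this]
      congr 2
      grind
  · rw [hs' u b hb]
    by_cases hu : u = t
    · subst hu
      simp [hb]
    · simp [hu]

theorem addWeight_spec (h : I.Located t s.arr) (ht : s.var .node = t)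
    (hq : s.var .q < I.numTerms) :
    Ensures addWeight s (1 + I.tableSize t * 3) fun s' => ∀ u, ∀ b < I.tableSize u,
      I.entries u (s'.arr .table) b = I.entries u (s.arr .table) b +
        if u = t then (if 1 < s.arr .sum b then I.weight (s.var .q) else 0) else 0 := by
  refine addToTable_spec (B := 2) h ht fun a _ s' hs' ha _ => ?_
  have hloc := h.frame hs'
  have hcell := eval_cell (x := .node) (e := var .a) hloc ((hs'.var _ (by decide)).trans ht)
    (congrArg _ ha)
  refine .ifLt (fun hlt => .put ?_) fun hle => .skip ?_
  · simp only [Exp.eval_ofNat, Exp.eval_get, Exp.eval_var, ha, Int.toNat_natCast,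
      hs'.arr .sum (by decide), Nat.cast_one] at hlt
    rw [hcell, Store.setArr_arr_self, Exp.eval_add, Exp.eval_get, hcell, Int.toNat_natCast,
      eval_weight hloc.encodes (by rwa [hs'.var _ (by decide)]), hs'.var _ (by decide), if_pos hlt]
  · simp only [Exp.eval_ofNat, Exp.eval_get, Exp.eval_var, ha, Int.toNat_natCast,
      hs'.arr .sum (by decide), Nat.cast_one] at hle
    rw [if_neg hle.not_gt, add_zero, Function.update_eq_self]

theorem findHome_spec (h : I.Preprocessed s.arr) (hq : s.var .q < I.numTerms) :
    Ensures findHome s 2 fun s' => s'.var .node = I.home (s.var .q) := by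
  have hleft := h.top _ (I.lt_of_mem _ _ (RootedInstance.left_mem_home hq))
  have hright := h.top _ (I.lt_of_mem _ _ (RootedInstance.right_mem_home hq))
  refine .ifLt (fun hlt => .set ?_) fun hle => .set ?_
  all_goals
    simp only [Exp.eval_get, Exp.eval_sub, eval_left h.encodes hq, eval_right h.encodes hq,
      Int.toNat_natCast, hleft, hright, Exp.eval_ofNat, Nat.cast_one, Store.setVar_var_self,
      RootedInstance.home] at *
    omega

theorem markTerm_spec (h : I.Encodes (s.arr .input)) (hq : s.var .q < I.numTerms)
    (hmark : s.arr .mark = 0) :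
    Ensures markTerm s 2 fun s' => ∀ v, s'.arr .mark v =
      (if v = I.left (s.var .q) then 1 else 0) + if v = I.right (s.var .q) then 1 else 0 := by
  refine .seq
    (.put (Q := fun s' => s'.arr .mark = Function.update (fun _ => 0) (I.left (s.var .q)) 1) ?_)
    fun s₁ hs₁ hmark₁ => .put fun v => ?_
  · simp [eval_left h hq, hmark]
    rfl
  · have hright := eval_right (s := s₁) (I := I) (by rwa [hs₁.arr _ (by decide)])
      (by rwa [hs₁.var _ (by decide)])
    rw [hs₁.var _ (by decide)] at hright
    simp only [Exp.eval_add, Exp.eval_get, hright, Int.toNat_natCast, hmark₁, Exp.eval_ofNat,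
      Store.setArr_arr_self, Function.update_apply, Nat.cast_one]
    split_ifs <;> simp_all

theorem unmarkTerm_spec (h : I.Encodes (s.arr .input)) (hq : s.var .q < I.numTerms)
    (hmark : ∀ v, v ≠ I.left (s.var .q) → v ≠ I.right (s.var .q) → s.arr .mark v = 0) :
    Ensures unmarkTerm s 2 fun s' => s'.arr .mark = 0 := by
  refine .seq (.put (Q := fun s' => s'.arr .mark =
    Function.update (s.arr .mark) (I.left (s.var .q)) 0) ?_) fun s₁ hs₁ hmark₁ => .put ?_
  · simp [eval_left h hq]
  · have hright := eval_right (s := s₁) (I := I) (by rwa [hs₁.arr _ (by decide)])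
      (by rwa [hs₁.var _ (by decide)])
    rw [hs₁.var _ (by decide)] at hright
    ext v
    simp only [hright, Int.toNat_natCast, hmark₁, Exp.eval_ofNat,
      Store.setArr_arr_self, Function.update_apply, Pi.zero_apply, Nat.cast_zero]
    split_ifs <;> simp_all

theorem addTerm_spec (h : I.Preprocessed s.arr) (hq : s.var .q < I.numTerms)
    (hmark : s.arr .mark = 0) :
    Ensures addTerm s (14 * I.tableSize (I.home (s.var .q))) fun s' => s'.arr .mark = 0 ∧
      ∀ u x, I.entries u (s'.arr .table) (I.idx u x) = I.entries u (s.arr .table) (I.idx u x) +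
        if u = I.home (s.var .q) then I.term (s.var .q) x else 0 := by
  have hloc := h.located _ (RootedInstance.home_lt hq)
  refine Ensures.mono (.seq (findHome_spec h hq) fun s₁ hs₁ hhome =>
    have hq₁ : s₁.var .q = s.var .q := hs₁.var _ (by decide)
    have hloc₁ := hloc.frame hs₁
    .seq (markTerm_spec hloc₁.encodes (by rwa [hq₁]) ((hs₁.arr _ (by decide)).trans hmark))
    fun s₂ hs₂ hmark₂ => .seq (subsetSums_spec (hloc₁.frame hs₂)
      ((hs₂.var _ (by decide)).trans hhome)) fun s₃ hs₃ hsum =>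
    have hq₃ : s₃.var .q = s.var .q :=
      (hs₃.var _ (by decide)).trans ((hs₂.var _ (by decide)).trans hq₁)
    have hloc₃ := (hloc₁.frame hs₂).frame hs₃
    .seq (addWeight_spec hloc₃ ((hs₃.var _ (by decide)).trans ((hs₂.var _ (by decide)).trans hhome))
      (by rwa [hq₃])) fun s₄ hs₄ htable =>
    have hq₄ : s₄.var .q = s.var .q := (hs₄.var _ (by decide)).trans hq₃
    (unmarkTerm_spec (hloc₃.frame hs₄).encodes (by rwa [hq₄]) fun v hl hr => ?_).mono le_rfl
    fun s₅ hs₅ hmark₅ => ⟨hmark₅, fun u x => ?_⟩) ?_ fun _ _ h => h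
  · rw [hq₄] at hl hr
    rw [hs₄.arr _ (by decide), hs₃.arr _ (by decide), hmark₂, hq₁, if_neg hl, if_neg hr, add_zero]
  · have := Nat.one_le_two_pow (n := (I.bag (I.home (s.var .q))).card)
    rw [RootedInstance.tableSize]
    omega
  · rw [hs₅.arr _ (by decide), htable u _ (RootedInstance.idx_lt u x), hs₃.arr .table (by decide),
      hs₂.arr .table (by decide), hs₁.arr .table (by decide), hq₃, RootedInstance.term_eq hq]
    rcases eq_or_ne u (I.home (s.var .q)) with rfl | hu
    · simp only [hsum, hmark₂, hq₁]
    · rw [if_neg hu, if_neg hu]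

theorem addTerms_spec {B : ℕ} (h : I.Preprocessed s.arr) (hmark : s.arr .mark = 0)
    (htable : s.arr .table = 0) (hB : ∀ t < I.numNodes, I.tableSize t ≤ B) :
    Ensures (.loop .q numTerms addTerm) s (1 + I.numTerms * (1 + 14 * B)) fun s' =>
      s'.arr .mark = 0 ∧ ∀ u x, I.entries u (s'.arr .table) (I.idx u x) =
        ∑ q ∈ Finset.range I.numTerms, if u = I.home q then I.term q x else 0 := by
  refine .loop_const (eval_numTerms h.encodes) (fun k s' => s'.arr .mark = 0 ∧
    ∀ u x, I.entries u (s'.arr .table) (I.idx u x) =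
      ∑ q ∈ Finset.range k, if u = I.home q then I.term q x else 0)
    ⟨hmark, fun u x => by simp [RootedInstance.entries, htable]⟩
    fun q hq s' hs' hsq hInv => ?_
  have hq' : s'.var .q < I.numTerms := by rwa [hsq]
  refine (addTerm_spec (h.frame hs') hq' hInv.1).mono
    (Nat.mul_le_mul_left _ (hB _ (RootedInstance.home_lt hq'))) fun s'' _ hs'' =>
    ⟨hs''.1, fun u x => ?_⟩
  rw [hs''.2, hInv.2, hsq, Finset.sum_range_succ]

end Cmd

/-! ### Elimination -/

namespace RootedInstance

/-- The marks on the separator of `t` are such that the index of an assignment to it is the sum of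
the marks of the variables that are `true`. -/
structure MarksSeparator (I : RootedInstance) (t : ℕ) (mark : ℕ → ℤ) : Prop where
  mark_elem : ∀ l < (I.bag t).card,
    mark (I.elem t l) = if I.top (I.elem t l) < t then 2 ^ l else 0
  eq_zero : ∀ v ∉ I.bag t, mark v = 0

theorem MarksSeparator.sum_eq_sepIdx {I : RootedInstance} {t u : ℕ} {mark : ℕ → ℤ}
    (h : I.MarksSeparator t mark) (hu : ∀ v ∈ I.bag t, I.top v < t → v ∈ I.bag u)
    (x : ℕ → Bool) : ∑ v ∈ I.bag u, (if x v then mark v else 0) = I.sepIdx t x := by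
  calc ∑ v ∈ I.bag u, (if x v then mark v else 0)
      = ∑ v ∈ I.bag t, (if x v then mark v else 0) := by
        refine Finset.sum_congr_of_eq_on_inter (fun v _ hv => ?_) (fun v hv hv' => ?_)
          fun _ _ _ => rfl
        · rw [h.eq_zero v hv, ite_self]
        · obtain ⟨l, hl, rfl⟩ := exists_elem_eq hv
          rw [h.mark_elem l hl, if_neg fun hlt => hv' (hu _ hv hlt), ite_self]
    _ = I.sepIdx t x := by
        rw [← sum_elem, sepIdx, idx, binary, Nat.cast_sum]
        refine Finset.sum_congr rfl fun l hl => ?_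
        rw [h.mark_elem l (Finset.mem_range.1 hl), above]
        cases x (I.elem t l) <;> by_cases ht : I.top (I.elem t l) < t <;> simp [ht]

end RootedInstance

theorem Exp.eval_entry {I : RootedInstance} {s : Store} {x : Var} {e : Exp} {t a : ℕ} {A : Arr}
    (h : I.Located t s.arr) (hx : s.var x = t) (he : e.eval s = a) :
    (get A (cell x e)).eval s = I.entries t (s.arr A) a := by
  rw [eval_get, eval_cell h hx he, Int.toNat_natCast, RootedInstance.entries]

namespace Cmd

open Exp (var get numNodes parent bagSize elem tableSize cell choice eval_bagSize eval_elem
  eval_tableSize eval_cell eval_entry eval_parent eval_numNodes)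

variable {I : RootedInstance} {s : Store} {t u : ℕ}

theorem markSeparator_spec (h : I.Preprocessed s.arr) (ht : t < I.numNodes) (hst : s.var .t = t)
    (hmark : s.arr .mark = 0) :
    Ensures markSeparator s (1 + (I.bag t).card * 3) fun s' =>
      I.MarksSeparator t (s'.arr .mark) := by
  have hloc := h.located t ht
  refine (Ensures.loop_const (B := 2) (eval_bagSize hloc hst) (fun k s' =>
    (∀ l < (I.bag t).card, s'.arr .mark (I.elem t l) =
      if l < k ∧ I.top (I.elem t l) < t then 2 ^ l else 0) ∧
    ∀ v ∉ I.bag t, s'.arr .mark v = 0) (by simp [hmark]) fun k hk s' hs' hsk hInv => ?_).mono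
    le_rfl fun s' _ hs' => ⟨fun l hl => by simpa [hl] using hs'.1 l hl, hs'.2⟩
  have hst' : s'.var .t = t := (hs'.var _ (by decide)).trans hst
  have hloc' := hloc.frame hs'
  have hpow := hloc'.pow k (hk.le.trans (RootedInstance.card_bag_le t))
  have helem := eval_elem (y := .i) hloc' hst' (by rwa [hsk])
  have htop := (h.frame hs').top _ (I.lt_of_mem _ _ (RootedInstance.elem_mem hk))
  rw [hsk] at helem
  refine .ifLt (fun hlt => .put ?_) fun hle => .skip ?_
  · have hlt : I.top (I.elem t k) < t := by simpa [helem, hst', htop] using hlt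
    simp only [helem, Int.toNat_natCast, Exp.eval_add, Exp.eval_get, Exp.eval_var, hsk, hpow,
      Store.setArr_arr_self]
    refine ⟨fun l hl => ?_, fun v hv => ?_⟩
    · simp only [Function.update_apply, hInv.1 l hl, hInv.1 k hk, RootedInstance.elem_inj hl hk]
      grind
    · rw [Function.update_of_ne (ne_of_mem_of_not_mem (RootedInstance.elem_mem hk) hv).symm,
        hInv.2 v hv]
  · have hle : ¬ I.top (I.elem t k) < t := by simpa [helem, hst', htop] using hle
    refine ⟨fun l hl => ?_, hInv.2⟩
    rw [hInv.1 l hl]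
    grind

theorem unmark_spec (h : I.Located t s.arr) (hst : s.var .t = t)
    (hmark : ∀ v ∉ I.bag t, s.arr .mark v = 0) :
    Ensures unmark s (1 + (I.bag t).card * 2) fun s' => s'.arr .mark = 0 := by
  refine (Ensures.loop_const (B := 1) (eval_bagSize h hst) (fun k s' =>
    (∀ l < k, s'.arr .mark (I.elem t l) = 0) ∧ ∀ v ∉ I.bag t, s'.arr .mark v = 0)
    (by simpa using hmark) fun k hk s' hs' hsk hInv => .put ?_).mono le_rfl fun s' _ hs' => ?_
  · rw [eval_elem (h.frame hs') ((hs'.var _ (by decide)).trans hst) (by rwa [hsk]), hsk]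
    simp only [Int.toNat_natCast, Store.setArr_arr_self, Function.update_apply, Exp.eval_ofNat,
      Nat.cast_zero]
    refine ⟨fun l hl => ?_, fun v hv => by simp [hInv.2 v hv]⟩
    split_ifs with heq
    · rfl
    · exact hInv.1 l ((Nat.lt_succ_iff.1 hl).lt_of_ne fun hlk => heq (by rw [hlk]))
  · ext v
    by_cases hv : v ∈ I.bag t
    · obtain ⟨l, hl, rfl⟩ := RootedInstance.exists_elem_eq hv
      exact hs'.1 l hl
    · exact hs'.2 v hv

theorem resetChoice_spec (h : I.Located t s.arr) (hst : s.var .t = t) :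
    Ensures resetChoice s (1 + I.tableSize t * 2) fun s' =>
      ∀ u, ∀ b < I.tableSize u, I.entries u (s'.arr .choice) b =
        if u = t then (b : ℤ) else I.entries u (s.arr .choice) b := by
  refine (Ensures.loop_const (B := 1) (eval_tableSize h hst) (fun k s' =>
    ∀ u, ∀ b < I.tableSize u, I.entries u (s'.arr .choice) b =
      if u = t ∧ b < k then (b : ℤ) else I.entries u (s.arr .choice) b) (by simp)
    fun k hk s' hs' hsk hInv => .put fun u b hb => ?_).mono le_rfl fun s' _ hs' u b hb => ?_
  · rw [eval_cell (h.frame hs') ((hs'.var _ (by decide)).trans hst) (congrArg _ hsk),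
      Int.toNat_natCast, Store.setArr_arr_self, RootedInstance.entries_update hk hb, hInv u b hb,
      Exp.eval_var, hsk]
    grind
  · rw [hs' u b hb]
    grind

theorem improveChoice_spec (h : I.Located t s.arr) (hst : s.var .t = t)
    (hsum : ∀ x, s.arr .sum (I.idx t x) = I.sepIdx t x)
    (hid : ∀ b < I.tableSize t, I.entries t (s.arr .choice) b = b) :
    Ensures improveChoice s (1 + I.tableSize t * 3) fun s' => ∃ g,
      I.IsBestExtension t (I.entries t (s.arr .table)) g ∧
      ∀ u, ∀ b < I.tableSize u, I.entries u (s'.arr .choice) b =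
        if u = t then (g b : ℤ) else I.entries u (s.arr .choice) b := by
  refine (Ensures.loop_const (B := 2) (eval_tableSize h hst) (fun k s' => ∃ g,
    I.IsBestExtensionBelow t k (I.entries t (s.arr .table)) g ∧
    ∀ u, ∀ b < I.tableSize u, I.entries u (s'.arr .choice) b =
      if u = t then (g b : ℤ) else I.entries u (s.arr .choice) b)
    ⟨id, .zero _ _ _, fun u b hb => by grind⟩ fun k hk s' hs' hsk ⟨g, hg, hchoice⟩ => ?_).mono
    le_rfl fun s' _ ⟨g, hg, hchoice⟩ => ⟨g, hg.isBestExtension, hchoice⟩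
  obtain ⟨x, hx⟩ := RootedInstance.exists_idx_eq hk
  have hloc := h.frame hs'
  have hst' := (hs'.var .t (by decide)).trans hst
  have htable := eval_entry (A := .table) (e := var .a) hloc hst' (congrArg _ hsk)
  have hsep : (get .sum (var .a)).eval s' = I.sepIdx t x := by
    rw [Exp.eval_get, Exp.eval_var, hsk, Int.toNat_natCast, hs'.arr _ (by decide), ← hx, hsum]
  have hbest : choice.eval s' = g (I.sepIdx t x) := by
    rw [choice, eval_entry hloc hst' hsep, hchoice t _ (RootedInstance.sepIdx_lt t x), if_pos rfl]
  refine .ifLt (fun hlt => .put ?_) fun hle => .skip ?_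
  · rw [htable, eval_entry hloc hst' hbest, hs'.arr _ (by decide)] at hlt
    refine ⟨_, hg.succ_of_lt hx hlt, fun u b hb => ?_⟩
    rw [eval_cell hloc hst' hsep, Int.toNat_natCast, Store.setArr_arr_self,
      RootedInstance.entries_update (RootedInstance.sepIdx_lt t x) hb, hchoice u b hb,
      Exp.eval_var, hsk, Function.update_apply]
    grind
  · rw [htable, eval_entry hloc hst' hbest, hs'.arr _ (by decide)] at hle
    exact ⟨g, hg.succ_of_le hx hle, hchoice⟩

theorem push_spec {g : ℕ → ℕ} (h : I.Located t s.arr) (hu : I.Located u s.arr) (hut : u ≠ t)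
    (hst : s.var .t = t) (hsu : s.var .node = u)
    (hsum : ∀ x, s.arr .sum (I.idx u x) = I.sepIdx t x)
    (hg : I.IsBestExtension t (I.entries t (s.arr .table)) g)
    (hchoice : ∀ b < I.tableSize t, I.entries t (s.arr .choice) b = g b) :
    Ensures push s (1 + I.tableSize u * 2) fun s' => ∀ w x,
      I.entries w (s'.arr .table) (I.idx w x) = I.entries w (s.arr .table) (I.idx w x) +
        if w = u then I.entries t (s.arr .table) (g (I.sepIdx t x)) else 0 := by
  refine (addToTable_spec (B := 1) (φ := fun a => I.entries t (s.arr .table)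
    (I.entries t (s.arr .choice) (s.arr .sum a).toNat).toNat) hu hsu
    fun a ha s' hs' hsa htable => .put ?_).mono le_rfl fun s' _ hs' w x => ?_
  · obtain ⟨x, rfl⟩ := RootedInstance.exists_idx_eq ha
    have hloc := h.frame hs'
    have hst' := (hs'.var .t (by decide)).trans hst
    have hcell := eval_cell (x := .node) (e := var .a) (hu.frame hs')
      ((hs'.var _ (by decide)).trans hsu) (congrArg _ hsa)
    have hsep : (get .sum (var .a)).eval s' = I.sepIdx t x := by
      rw [Exp.eval_get, Exp.eval_var, hsa, Int.toNat_natCast, hs'.arr _ (by decide), hsum]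
    have hbest : choice.eval s' = g (I.sepIdx t x) := by
      rw [choice, eval_entry hloc hst' hsep, hs'.arr _ (by decide),
        hchoice _ (RootedInstance.sepIdx_lt t x)]
    rw [hcell, Store.setArr_arr_self, Exp.eval_add, Exp.eval_get, hcell, Int.toNat_natCast,
      eval_entry hloc hst' hbest, htable t hut.symm _ (hg.lt x), hsum, Int.toNat_natCast,
      hchoice _ (RootedInstance.sepIdx_lt t x), Int.toNat_natCast]
  · rw [hs' w _ (RootedInstance.idx_lt w x)]
    split_ifs with hw
    · rw [hw, hsum, Int.toNat_natCast, hchoice _ (RootedInstance.sepIdx_lt t x), Int.toNat_natCast]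
    · rfl

theorem pushToParent_spec {g : ℕ → ℕ} {B : ℕ} (h : I.Preprocessed s.arr) (ht : t < I.numNodes)
    (hst : s.var .t = t) (hmark : I.MarksSeparator t (s.arr .mark))
    (hg : I.IsBestExtension t (I.entries t (s.arr .table)) g)
    (hchoice : ∀ b < I.tableSize t, I.entries t (s.arr .choice) b = g b)
    (hB : ∀ u < I.numNodes, I.tableSize u ≤ B) :
    Ensures pushToParent s (3 + 6 * B) fun s' => ∀ w x,
      I.entries w (s'.arr .table) (I.idx w x) = I.entries w (s.arr .table) (I.idx w x) +
        if 0 < t ∧ w = I.parent t then I.entries t (s.arr .table) (g (I.sepIdx t x)) else 0 := by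
  refine Ensures.mono (.ifLt (B := 2 + 6 * B) (fun hlt => ?_) fun hle => (Ensures.skip ?_).mono
    (by omega) fun _ _ h => h) (by omega) fun _ _ h => h
  · have h0 : 0 < t := by simpa [hst] using hlt
    have hpt := I.parent_lt t h0
    have hp := hpt.trans ht
    have hloc := h.located t ht
    refine Ensures.mono (.seq (.set (Q := fun s' => s'.var .node = I.parent t)
      (by simp [eval_parent hloc hst h0])) fun s₁ hs₁ hnode => .seq
      (subsetSums_spec ((h.located _ hp).frame hs₁) hnode) fun s₂ hs₂ hsum =>
      (push_spec (g := g) ((hloc.frame hs₁).frame hs₂) (((h.located _ hp).frame hs₁).frame hs₂)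
        hpt.ne ((hs₂.var _ (by decide)).trans ((hs₁.var _ (by decide)).trans hst))
        ((hs₂.var _ (by decide)).trans hnode) (fun x => ?_) ?_ ?_).mono le_rfl
        fun s' _ hs' w x => ?_) ?_ fun _ _ h => h
    · rw [hsum, hs₁.arr .mark (by decide),
        hmark.sum_eq_sepIdx fun v hv => RootedInstance.mem_parent_of_top_lt hv]
    · rwa [hs₂.arr .table (by decide), hs₁.arr .table (by decide)]
    · rwa [hs₂.arr .choice (by decide), hs₁.arr .choice (by decide)]
    · simp only [hs' w x, hs₂.arr .table (by decide), hs₁.arr .table (by decide), h0, true_and]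
    · have := hB _ hp
      omega
  · have h0 : t = 0 := by simpa [hst] using hle
    simp [h0]

theorem chooseExtensions_spec (h : I.Preprocessed s.arr) (ht : t < I.numNodes)
    (hst : s.var .t = t) (hmark : s.arr .mark = 0) :
    Ensures chooseExtensions s (4 + (I.bag t).card * 3 + I.tableSize t * 9) fun s' =>
      I.MarksSeparator t (s'.arr .mark) ∧ ∃ g,
        I.IsBestExtension t (I.entries t (s.arr .table)) g ∧
        ∀ u, ∀ b < I.tableSize u, I.entries u (s'.arr .choice) b =
          if u = t then (g b : ℤ) else I.entries u (s.arr .choice) b := by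
  have hloc := h.located t ht
  refine Ensures.mono (.seq (markSeparator_spec h ht hst hmark) fun s₁ hs₁ hmark₁ =>
    have hst₁ := (hs₁.var .t (by decide)).trans hst
    .seq (.set (Q := fun s' => s'.var .node = t) (by simp [hst₁])) fun s₂ hs₂ hnode =>
    have hst₂ := (hs₂.var .t (by decide)).trans hst₁
    have hloc₂ := (hloc.frame hs₁).frame hs₂
    .seq (subsetSums_spec hloc₂ hnode) fun s₃ hs₃ hsum =>
    have hst₃ := (hs₃.var .t (by decide)).trans hst₂
    .seq (resetChoice_spec (hloc₂.frame hs₃) hst₃) fun s₄ hs₄ hreset =>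
    (improveChoice_spec ((hloc₂.frame hs₃).frame hs₄) ((hs₄.var .t (by decide)).trans hst₃)
      (fun x => ?_) fun b hb => by rw [hreset t b hb, if_pos rfl]).mono le_rfl
      fun s' hs' ⟨g, hg, hchoice⟩ => ⟨?_, g, ?_, fun u b hb => ?_⟩) ?_ fun _ _ h => h
  · rw [hs₄.arr .sum (by decide), hsum, hs₂.arr .mark (by decide),
      hmark₁.sum_eq_sepIdx fun v hv _ => hv]
  · omega
  · rwa [hs'.arr .mark (by decide), hs₄.arr .mark (by decide), hs₃.arr .mark (by decide),
      hs₂.arr .mark (by decide)]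
  · rwa [hs₄.arr .table (by decide), hs₃.arr .table (by decide), hs₂.arr .table (by decide),
      hs₁.arr .table (by decide)] at hg
  · rw [hchoice u b hb, hreset u b hb, hs₃.arr .choice (by decide), hs₂.arr .choice (by decide),
      hs₁.arr .choice (by decide)]
    split_ifs <;> rfl

theorem eliminateNode_spec {B : ℕ} (h : I.Preprocessed s.arr) (ht : t < I.numNodes)
    (hst : s.var .t = t) (hmark : s.arr .mark = 0) (hB : ∀ u < I.numNodes, I.tableSize u ≤ B) :
    Ensures eliminateNode s (28 * B) fun s' => s'.arr .mark = 0 ∧ ∃ g,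
      I.IsBestExtension t (I.entries t (s.arr .table)) g ∧
      (∀ u, ∀ b < I.tableSize u, I.entries u (s'.arr .choice) b =
        if u = t then (g b : ℤ) else I.entries u (s.arr .choice) b) ∧
      ∀ u x, I.entries u (s'.arr .table) (I.idx u x) = I.entries u (s.arr .table) (I.idx u x) +
        if 0 < t ∧ u = I.parent t then I.entries t (s.arr .table) (g (I.sepIdx t x)) else 0 := by
  refine Ensures.mono (.seq (chooseExtensions_spec h ht hst hmark)
    fun s₁ hs₁ ⟨hmark₁, g, hg, hchoice⟩ =>
    have hst₁ := (hs₁.var .t (by decide)).trans hst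
    have htable₁ := hs₁.arr .table (by decide)
    .seq (pushToParent_spec (g := g) (h.frame hs₁) ht hst₁ hmark₁ (by rwa [htable₁])
      (fun b hb => by rw [hchoice t b hb, if_pos rfl]) hB) fun s₂ hs₂ htable =>
    (unmark_spec (((h.located t ht).frame hs₁).frame hs₂) ((hs₂.var .t (by decide)).trans hst₁)
      (by rw [hs₂.arr .mark (by decide)]; exact hmark₁.eq_zero)).mono le_rfl
      fun s' hs' hmark' => ⟨hmark', g, hg, fun u b hb => ?_, fun u x => ?_⟩) ?_ fun _ _ h => h
  · have hcard : (I.bag t).card < I.tableSize t := Nat.lt_two_pow_self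
    have := hB t ht
    omega
  · rw [hs'.arr .choice (by decide), hs₂.arr .choice (by decide), hchoice u b hb]
  · rw [hs'.arr .table (by decide), htable, htable₁]

theorem eliminate_spec {B : ℕ} (h : I.Preprocessed s.arr) (hmark : s.arr .mark = 0)
    (htable : ∀ u x, I.entries u (s.arr .table) (I.idx u x) =
      ∑ q ∈ Finset.range I.numTerms, if u = I.home q then I.term q x else 0)
    (hB : ∀ u < I.numNodes, I.tableSize u ≤ B) :
    Ensures eliminate s (1 + I.numNodes * (2 + 28 * B)) fun s' => ∃ f g, I.Elimination 0 f g ∧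
      ∀ u < I.numNodes, ∀ b < I.tableSize u, I.entries u (s'.arr .choice) b = g u b := by
  refine (Ensures.loop_const (B := 1 + 28 * B) (eval_numNodes h.encodes) (fun r s' =>
    s'.arr .mark = 0 ∧ ∃ g,
      I.Elimination (I.numNodes - r) (fun u => I.entries u (s'.arr .table)) g ∧
      ∀ u < I.numNodes, I.numNodes - r ≤ u → ∀ b < I.tableSize u,
        I.entries u (s'.arr .choice) b = g u b)
    ⟨hmark, fun _ _ => 0, .initial fun u _ => htable u, fun u hu hu' => absurd hu hu'.not_gt⟩
    fun r hr s' hs' hsr ⟨hmark', g, hg, hchoice⟩ => ?_).mono (by ring_nf; rfl)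
    fun s' _ ⟨_, g, hg, hchoice⟩ => ?_
  · obtain ⟨t, ht⟩ : ∃ t, I.numNodes - r = t + 1 := Nat.exists_eq_succ_of_ne_zero (by omega)
    have ht' : I.numNodes - (r + 1) = t := by omega
    rw [ht] at hg hchoice
    rw [ht']
    refine .seq (.set (Q := fun s' => s'.var .t = t) ?_) fun s₁ hs₁ hst =>
      (eliminateNode_spec ((h.frame hs').frame hs₁) (by omega) hst
        ((hs₁.arr _ (by decide)).trans hmark') hB).mono le_rfl
      fun s₂ _ ⟨hmark₂, g', hg', hchoice', htable'⟩ =>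
      ⟨hmark₂, Function.update g t g', ?_, fun u hu htu b hb => ?_⟩
    · simp [eval_numNodes (h.frame hs').encodes, hsr]
      omega
    · rw [hs₁.arr .table (by decide)] at hg' htable'
      refine hg.step (by omega) (by rwa [Function.update_self]) (fun u _ htu x => ?_)
        fun u _ x => ?_
      · rw [Function.update_of_ne htu.ne']
      · rw [htable', Function.update_self]
    · rw [hchoice' u b hb, hs₁.arr .choice (by decide)]
      split_ifs with hut
      · rw [hut, Function.update_self]
      · rw [Function.update_of_ne hut, hchoice u hu (by omega) b hb]
  · rw [Nat.sub_self] at hg hchoice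
    exact ⟨_, g, hg, fun u hu => hchoice u hu u.zero_le⟩

end Cmd

/-! ### Decoding -/

namespace Cmd

open Exp (var get numVars numNodes bagSize elem cell eval_bagSize eval_elem eval_entry eval_numNodes
  eval_numVars)

variable {I : RootedInstance} {s : Store} {t : ℕ}

theorem computeKey_spec {x : ℕ → Bool} (h : I.Located t s.arr) (hst : s.var .t = t)
    (hsol : ∀ v, s.arr .sol v = (x v).toNat) :
    Ensures computeKey s (2 + (I.bag t).card * 3) fun s' => s'.var .key = I.idx t x := by
  refine Ensures.mono (.seq (.set (Q := fun s' => s'.var .key = 0) (by simp)) fun s₁ hs₁ hkey =>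
    .loop_const (B := 2) (eval_bagSize (h.frame hs₁) ((hs₁.var _ (by decide)).trans hst))
      (fun k s' => s'.var .key = binary k fun l => x (I.elem t l)) (by simpa [binary] using hkey)
      (fun k hk s' hs' hsk hInv => ?_) ?_) (by omega) fun _ _ h => h
  · have helem := eval_elem (x := .t) (y := .i) ((h.frame hs₁).frame hs')
      ((hs'.var _ (by decide)).trans ((hs₁.var _ (by decide)).trans hst)) (by rwa [hsk])
    have hpow := ((h.frame hs₁).frame hs').pow k (hk.le.trans (RootedInstance.card_bag_le t))
    have hdigit : (get .sol (elem .t .i)).eval s' = (x (I.elem t k)).toNat := by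
      rw [Exp.eval_get, helem, hsk, Int.toNat_natCast, hs'.arr .sol (by decide),
        hs₁.arr .sol (by decide), hsol]
    refine .ifLt (fun hlt => .set ?_) fun hle => .skip ?_
    · rw [hdigit] at hlt
      have hx : x (I.elem t k) = true := by cases hx : x (I.elem t k) <;> simp_all
      simp only [Store.setVar_var_self, Exp.eval_add, Exp.eval_get, Exp.eval_var, hInv, hsk,
        Int.toNat_natCast, hpow, binary_succ, hx]
      rw [← Nat.cast_add, Int.toNat_natCast]
      simp
    · rw [hdigit] at hle
      have hx : x (I.elem t k) = false := by simpa using hle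
      rw [binary_succ, hInv, hx, Bool.toNat_false, zero_mul, add_zero]
  · exact fun k s' hs' => hs'

theorem assignDigit_spec {j : ℕ} {z : ℕ → Bool} (h : I.Located t s.arr) (hst : s.var .t = t)
    (hsj : s.var .j = j) (hj : j < (I.bag t).card) (hbest : s.var .best = binary (j + 1) z) :
    Ensures assignDigit s 3 fun s' => s'.var .best = binary j z ∧
      s'.arr .sol = Function.update (s.arr .sol) (I.elem t j) (z j).toNat := by
  have helem := eval_elem (x := .t) (y := .j) h hst (by rwa [hsj])
  have hpow : (get .pow (var .j)).eval s = (2 ^ j : ℕ) := by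
    rw [Exp.eval_get, Exp.eval_var, hsj, Int.toNat_natCast,
      h.pow j (hj.le.trans (RootedInstance.card_bag_le t))]
  have hlow := binary_lt j z
  rw [binary_succ] at hbest
  refine .ifLt (fun hlt => (Ensures.put ?_).mono (by omega) fun _ _ h => h) fun hle =>
    .seq (.put (Q := fun s' => s'.arr .sol = Function.update (s.arr .sol) (I.elem t j) 1)
      (by simp [helem, hsj])) fun s₁ hs₁ hsol => .set ?_
  · rw [hpow, Exp.eval_var, Nat.cast_lt] at hlt
    have hz : z j = false := by cases hz : z j <;> simp_all
    simp [helem, hsj, hbest, hz]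
  · rw [hpow, Exp.eval_var, Nat.cast_le] at hle
    have hz : z j = true := by
      cases hz : z j
      · simp [hz] at hbest
        omega
      · rfl
    have hpow₁ : (get .pow (var .j)).eval s₁ = (2 ^ j : ℕ) := by
      rw [Exp.eval_get, Exp.eval_var, hs₁.arr .pow (by decide), hs₁.var .j (by decide)]
      exact hpow
    rw [Store.setVar_var_self, Exp.eval_sub, hpow₁, Exp.eval_var, hs₁.var .best (by decide), hbest]
    refine ⟨?_, by rw [hz]; exact hsol⟩
    rw [hz, Bool.toNat_true]
    omega

theorem assignDigits_spec {y : ℕ → Bool} (h : I.Located t s.arr) (hst : s.var .t = t)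
    (hbest : s.var .best = I.idx t y) (hsol : ∀ v ∉ I.bag t, s.arr .sol v = (y v).toNat) :
    Ensures assignDigits s (1 + (I.bag t).card * 5) fun s' =>
      ∀ v, s'.arr .sol v = (y v).toNat := by
  refine (Ensures.loop_const (B := 4) (eval_bagSize h hst) (fun k s' =>
    s'.var .best = binary ((I.bag t).card - k) (fun l => y (I.elem t l)) ∧
    (∀ l < (I.bag t).card, (I.bag t).card - k ≤ l →
      s'.arr .sol (I.elem t l) = (y (I.elem t l)).toNat) ∧
    ∀ v ∉ I.bag t, s'.arr .sol v = (y v).toNat) ⟨hbest, by omega, hsol⟩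
    fun k hk s' hs' hsk hInv => ?_).mono le_rfl fun s' _ ⟨_, hbag, hsol'⟩ v => ?_
  · obtain ⟨j, hj⟩ : ∃ j, (I.bag t).card - k = j + 1 := Nat.exists_eq_succ_of_ne_zero (by omega)
    have hj' : (I.bag t).card - (k + 1) = j := by omega
    have hst' := (hs'.var .t (by decide)).trans hst
    rw [hj] at hInv
    rw [hj']
    refine .seq (.set (Q := fun s' => s'.var .j = j) ?_) fun s₁ hs₁ hsj =>
      (assignDigit_spec ((h.frame hs').frame hs₁) ((hs₁.var .t (by decide)).trans hst') hsj
        (by omega) (z := fun l => y (I.elem t l)) ?_).mono le_rfl fun s₂ _ ⟨hbest₂, hsol₂⟩ =>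
      ⟨hbest₂, fun l hl hjl => ?_, fun v hv => ?_⟩
    · rw [Store.setVar_var_self, Exp.eval_sub, eval_bagSize (h.frame hs') hst', Exp.eval_add,
        Exp.eval_var, hsk, Exp.eval_ofNat, Nat.cast_one]
      omega
    · rw [hs₁.var .best (by decide), hInv.1]
    · rw [hsol₂, hs₁.arr .sol (by decide), Function.update_apply]
      split_ifs with heq
      · rw [heq]
      · exact hInv.2.1 l hl (hjl.lt_of_ne fun hjl => heq (by rw [hjl]))
    · rw [hsol₂, hs₁.arr .sol (by decide), Function.update_of_ne
        (ne_of_mem_of_not_mem (RootedInstance.elem_mem (by omega)) hv).symm, hInv.2.2 v hv]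
  · by_cases hv : v ∈ I.bag t
    · obtain ⟨l, hl, rfl⟩ := RootedInstance.exists_elem_eq hv
      exact hbag l hl (by omega)
    · exact hsol' v hv

theorem decodeNode_spec {g : ℕ → ℕ → ℕ} {f : ℕ → ℤ} {x : ℕ → Bool} (h : I.Located t s.arr)
    (hst : s.var .t = t) (hsol : ∀ v, s.arr .sol v = (x v).toNat) (hx : I.Decoded g t x)
    (hbest : I.IsBestExtension t f (g t))
    (hchoice : ∀ b < I.tableSize t, I.entries t (s.arr .choice) b = g t b) :
    Ensures decodeNode s (4 + (I.bag t).card * 8) fun s' => ∃ y, I.Decoded g (t + 1) y ∧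
      ∀ v, s'.arr .sol v = (y v).toNat := by
  obtain ⟨z, -, hz⟩ := hbest.exists_extension x
  rw [hx.sepIdx_eq] at hz
  let y v := if v ∈ I.bag t then z v else x v
  have hyz : I.idx t y = g t (I.idx t x) :=
    (RootedInstance.idx_congr fun v hv => if_pos hv).trans hz
  have hyx : ∀ v ∉ I.bag t, y v = x v := fun v hv => if_neg hv
  refine Ensures.mono (.seq (computeKey_spec h hst hsol) fun s₁ hs₁ hkey =>
    have hst₁ := (hs₁.var .t (by decide)).trans hst
    .seq (.set (Q := fun s' => s'.var .best = g t (I.idx t x)) ?_) fun s₂ hs₂ hbest₂ =>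
    (assignDigits_spec ((h.frame hs₁).frame hs₂) ((hs₂.var .t (by decide)).trans hst₁)
      (hbest₂.trans hyz.symm) fun v hv => ?_).mono le_rfl
    fun s' _ hs' => ⟨y, hx.step hbest hyz hyx, hs'⟩) (by omega) fun _ _ h => h
  · rw [Store.setVar_var_self, eval_entry (h.frame hs₁) hst₁ (congrArg _ hkey),
      hs₁.arr .choice (by decide), hchoice _ (RootedInstance.idx_lt t x), Int.toNat_natCast]
  · rw [hs₂.arr .sol (by decide), hs₁.arr .sol (by decide), hsol, hyx v hv]

theorem decode_spec {f : ℕ → ℕ → ℤ} {g : ℕ → ℕ → ℕ} {B : ℕ} (h : I.Preprocessed s.arr)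
    (hsol : s.arr .sol = 0) (hbest : ∀ t < I.numNodes, I.IsBestExtension t (f t) (g t))
    (hchoice : ∀ t < I.numNodes, ∀ b < I.tableSize t, I.entries t (s.arr .choice) b = g t b)
    (hB : ∀ t < I.numNodes, I.tableSize t ≤ B) :
    Ensures decode s (1 + I.numNodes * (1 + 12 * B)) fun s' => ∃ x,
      I.Decoded g I.numNodes x ∧ ∀ v, s'.arr .sol v = (x v).toNat := by
  refine .loop_const (eval_numNodes h.encodes) (fun t s' => ∃ x,
    I.Decoded g t x ∧ ∀ v, s'.arr .sol v = (x v).toNat)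
    ⟨fun _ => false, ⟨fun _ hu => absurd hu (Nat.not_lt_zero _), fun _ _ => rfl⟩,
      by simp [hsol]⟩ fun t ht s' hs' hst ⟨x, hx, hsol'⟩ =>
    (decodeNode_spec ((h.located t ht).frame hs') hst hsol' hx (hbest t ht) ?_).mono ?_
      fun _ _ h => h
  · rw [hs'.arr .choice (by decide)]
    exact hchoice t ht
  · have hcard : (I.bag t).card < I.tableSize t := Nat.lt_two_pow_self
    have := hB t ht
    omega

theorem output_spec (h : I.Encodes (s.arr .input)) :
    Ensures output s (1 + I.numVars * 2) fun s' =>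
      ∀ v < I.numVars, s'.arr .input v = s.arr .sol v := by
  refine .loop_const (B := 1) (eval_numVars h)
    (fun k s' => ∀ v < k, s'.arr .input v = s.arr .sol v) (by simp)
    fun k _ s' hs' hsk hInv => .put fun v hv => ?_
  simp only [Exp.eval_var, Exp.eval_get, hsk, Int.toNat_natCast, Store.setArr_arr_self,
    Function.update_apply, hs'.arr .sol (by decide)]
  split_ifs with hvk
  · rw [hvk]
  · exact hInv v (by omega)

theorem solve_spec {B : ℕ} (h : I.Encodes (s.arr .input))
    (hs : ∀ A, A ≠ .input → s.arr A = 0) (hB : ∀ t < I.numNodes, I.tableSize t ≤ B) (hB' : 1 ≤ B) :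
    Ensures solve s (52 * B * (1 + I.numVars + I.numTerms + I.numNodes)) fun s' =>
      ∃ x, (∀ y, I.energy x ≤ I.energy y) ∧ ∀ v < I.numVars, s'.arr .input v = (x v).toNat := by
  have hcard : ∑ t ∈ Finset.range I.numNodes, (6 + 3 * (I.bag t).card) ≤
      I.numNodes * (6 + 3 * B) := by
    refine (Finset.sum_le_card_nsmul _ _ (6 + 3 * B) fun t ht => ?_).trans (by simp)
    have hcard : (I.bag t).card < I.tableSize t := Nat.lt_two_pow_self
    have := hB t (Finset.mem_range.1 ht)
    omega
  refine Ensures.mono (.seq (computePowers_spec h) fun s₁ hs₁ hpow =>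
    .seq (readNodes_spec (I := I) (by rwa [hs₁.arr .input (by decide)]) hpow
      (by simp [hs₁.arr .top (by decide), hs])) fun s₂ hs₂ hpre =>
    .seq (addTerms_spec hpre
      (by rw [hs₂.arr .mark (by decide), hs₁.arr .mark (by decide), hs _ (by decide)])
      (by rw [hs₂.arr .table (by decide), hs₁.arr .table (by decide), hs _ (by decide)]) hB)
    fun s₃ hs₃ ⟨hmark, htable⟩ =>
    .seq (eliminate_spec (hpre.frame hs₃) hmark htable hB) fun s₄ hs₄ ⟨f, g, hfg, hchoice⟩ =>
    .seq (decode_spec ((hpre.frame hs₃).frame hs₄) (by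
      rw [hs₄.arr .sol (by decide), hs₃.arr .sol (by decide), hs₂.arr .sol (by decide),
        hs₁.arr .sol (by decide), hs _ (by decide)]) (fun t ht => hfg.best t ht t.zero_le)
      hchoice hB) fun s₅ hs₅ ⟨x, hx, hsol⟩ =>
    (output_spec (((hpre.frame hs₃).frame hs₄).frame hs₅).encodes).mono le_rfl
      fun s' _ hs' => ⟨x, hfg.energy_le hx.idx_eq, fun v hv => by rw [hs' v hv, hsol]⟩) ?_
    fun _ _ h => h
  nlinarith [Nat.mul_le_mul_left I.numVars hB', Nat.mul_le_mul_left I.numTerms hB',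
    Nat.mul_le_mul_left I.numNodes hB']

end Cmd

/-! ### From presentations to rooted instances -/

/-- `parent` orients the edges of `G` towards the root `r`, which precedes all its descendants. -/
structure IsParentMap {V : Type*} [Preorder V] (G : SimpleGraph V) (r : V) (parent : V → V) :
    Prop where
  lt : ∀ v ≠ r, parent v < v
  adj : ∀ v ≠ r, G.Adj (parent v) v

namespace IsParentMap

variable {V : Type*} {G : SimpleGraph V} {r u v : V} {parent : V → V}

theorem injOn_edge [Preorder V] (h : IsParentMap G r parent) :
    Set.InjOn (fun v => s(parent v, v)) {v | v ≠ r} := by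
  intro u hu v hv huv
  rcases Sym2.eq_iff.1 huv with ⟨-, huv⟩ | ⟨hu', hv'⟩
  · exact huv
  · have hlt := h.lt u hu
    rw [hu'] at hlt
    rw [hv'] at hlt
    exact absurd (h.lt v hv) hlt.not_gt

/-- There are as many edges of this form as edges of a tree. -/
theorem eq_or_eq_of_adj [Preorder V] [Finite V] (h : IsParentMap G r parent) (hG : G.IsTree)
    (huv : G.Adj u v) : (v ≠ r ∧ parent v = u) ∨ (u ≠ r ∧ parent u = v) := by
  classical
  have := Fintype.ofFinite V
  have hsub : (Finset.univ.erase r).image (fun v => s(parent v, v)) ⊆ G.edgeFinset := by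
    simp only [Finset.image_subset_iff, Finset.mem_erase, SimpleGraph.mem_edgeFinset]
    exact fun v hv => h.adj v hv.1
  have hcard : G.edgeFinset.card ≤
      ((Finset.univ.erase r).image fun v => s(parent v, v)).card := by
    rw [Finset.card_image_of_injOn (by simpa [Set.InjOn] using h.injOn_edge),
      Finset.card_erase_of_mem (Finset.mem_univ r), Finset.card_univ, ← hG.card_edgeFinset]
    simp
  have hmem := SimpleGraph.mem_edgeFinset.2 (G.mem_edgeSet.2 huv)
  rw [← Finset.eq_of_subset_of_card_le hsub hcard] at hmem
  obtain ⟨w, hw, hwuv⟩ := Finset.mem_image.1 hmem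
  have hw := Finset.ne_of_mem_erase hw
  rcases Sym2.eq_iff.1 hwuv with ⟨hp, rfl⟩ | ⟨hp, rfl⟩
  · exact .inl ⟨hw, hp⟩
  · exact .inr ⟨hw, hp⟩

/-- Otherwise the walks in `s` which start at `v` reach only descendants of `v`. -/
theorem parent_mem [Preorder V] [Finite V] (h : IsParentMap G r parent) (hG : G.IsTree) {s : Set V}
    (hs : (G.induce s).Connected) (hu : u ∈ s) (hv : v ∈ s) (huv : u < v) : parent v ∈ s := by
  by_contra hp
  have hdesc (w : s) (hw : Relation.ReflTransGen (G.induce s).Adj ⟨v, hv⟩ w) :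
      Relation.ReflTransGen (fun a b => a ≠ r ∧ parent a = b) w.1 v := by
    induction hw with
    | refl => exact .refl
    | @tail a b _ hab ih =>
      rcases h.eq_or_eq_of_adj hG hab with hba | hab
      · exact ih.head hba
      · obtain hb : parent a = b := hab.2
        rcases ih.cases_head with ha | ⟨c, ⟨-, hc⟩, hcv⟩
        · exact absurd (by simpa only [← ha, hb] using b.2) hp
        · rwa [← hb, hc]
  have hle (w : V) (hw : Relation.ReflTransGen (fun a b => a ≠ r ∧ parent a = b) w v) : v ≤ w := by
    induction hw using Relation.ReflTransGen.head_induction_on with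
    | refl => exact le_rfl
    | head hac _ ih => exact ih.trans (hac.2 ▸ (h.lt _ hac.1).le)
  exact (hle u (hdesc ⟨u, hu⟩ ((SimpleGraph.reachable_iff_reflTransGen _ _).1
    (hs.preconnected _ _)))).not_gt huv

end IsParentMap

theorem length_flatMap_range {α : Type*} (f : ℕ → List α) (t : ℕ) :
    ((List.range t).flatMap f).length = ∑ u ∈ Finset.range t, (f u).length := by
  induction t with
  | zero => rfl
  | succ t ih => simp [List.range_succ, Finset.sum_range_succ, ih]

theorem getD_flatMap_range {α : Type*} (f : ℕ → List α) (d : α) (post : List α) {m t j : ℕ}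
    (ht : t < m) (hj : j < (f t).length) :
    ((List.range m).flatMap f ++ post).getD (∑ u ∈ Finset.range t, (f u).length + j) d =
      (f t).getD j d := by
  obtain ⟨k, rfl⟩ := Nat.exists_eq_add_of_lt ht
  rw [show t + k + 1 = t + (k + 1) by omega, List.range_add, List.flatMap_append,
    List.append_assoc, ← length_flatMap_range, List.getD_append_right _ _ _ _ (by omega),
    Nat.add_sub_cancel_left, List.range_succ_eq_map]
  simp [List.getElem?_append, hj]

/-- The description of a rooted instance as a list of integers, in the format of
`Presentation.encode`. -/
def RootedInstance.encode (I : RootedInstance) : List ℤ :=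
  [(I.numVars : ℤ), (I.numTerms : ℤ)]
    ++ (List.range I.numTerms).flatMap (fun q => [(I.left q : ℤ), (I.right q : ℤ), I.weight q])
    ++ [(I.numNodes : ℤ)]
    ++ (List.range I.numNodes).flatMap (fun t =>
        [(I.parent t : ℤ), ((I.bag t).card : ℤ)]
          ++ (List.range (I.bag t).card).map fun l => (I.elem t l : ℤ))

namespace RootedInstance

variable (I : RootedInstance)

theorem getD_encode_term {q j : ℕ} (hq : q < I.numTerms) (hj : j < 3) :
    I.encode.getD (2 + 3 * q + j) 0 = [(I.left q : ℤ), (I.right q : ℤ), I.weight q].getD j 0 := by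
  rw [encode, List.append_assoc, List.append_assoc, List.getD_append_right _ _ _ _ (by simp; omega)]
  convert getD_flatMap_range (fun q => [(I.left q : ℤ), (I.right q : ℤ), I.weight q]) 0 _ hq hj
    using 2
  simp
  omega

theorem getD_encode_numNodes : I.encode.getD (2 + 3 * I.numTerms) 0 = I.numNodes := by
  rw [encode, List.append_assoc, List.getD_append_right _ _ _ _ (by simp; omega)]
  simp [show 2 + 3 * I.numTerms - (I.numTerms * 3 + 1 + 1) = 0 by omega]

theorem getD_encode_node {t j : ℕ} (ht : t < I.numNodes) (hj : j < 2 + (I.bag t).card) :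
    I.encode.getD (I.start t + j) 0 = ([(I.parent t : ℤ), ((I.bag t).card : ℤ)] ++
      (List.range (I.bag t).card).map fun l => (I.elem t l : ℤ)).getD j 0 := by
  have h := getD_flatMap_range (fun t => [(I.parent t : ℤ), ((I.bag t).card : ℤ)] ++
    (List.range (I.bag t).card).map fun l => (I.elem t l : ℤ)) 0 [] ht (j := j) (by simp; omega)
  simp only [List.append_nil, List.length_append, List.length_cons, List.length_nil,
    List.length_map, List.length_range, zero_add, Nat.reduceAdd] at h
  rw [← h, encode, List.getD_append_right _ _ _ _ (by simp [start]; omega)]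
  congr 1
  simp [start]
  omega

theorem encodes_encode : I.Encodes fun i => I.encode.getD i 0 where
  numVars := rfl
  numTerms := rfl
  left _ hq := I.getD_encode_term hq (j := 0) (by norm_num)
  right q hq := by
    rw [show 3 + 3 * q = 2 + 3 * q + 1 by omega, I.getD_encode_term hq (by norm_num)]
    rfl
  weight q hq := by
    rw [show 4 + 3 * q = 2 + 3 * q + 2 by omega, I.getD_encode_term hq (by norm_num)]
    rfl
  numNodes := I.getD_encode_numNodes
  parent _ ht _ := I.getD_encode_node ht (j := 0) (by omega)
  card_bag _ ht := I.getD_encode_node ht (j := 1) (by omega)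
  elem _ ht l hl := by
    rw [add_assoc, I.getD_encode_node ht (by omega),
      List.getD_append_right _ _ _ _ (Nat.le_add_right 2 l)]
    simp [hl]

end RootedInstance

section Presentation

variable {H : Hamiltonian} {D : TreeDecomposition H.primalGraph} (I : Presentation H D)

/-- The bag of the node `t`, or `[]` if there is no such node, with variables as natural numbers. -/
def bagList (t : ℕ) : List ℕ := if ht : t < D.m then (I.bags ⟨t, ht⟩).map Fin.val else []

theorem bagList_eq (t : Fin D.m) : bagList I t = (I.bags t).map Fin.val := by simp [bagList]

theorem nodup_bagList (t : ℕ) : (bagList I t).Nodup := by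
  unfold bagList
  split
  · exact (I.bags_nodup _).map Fin.val_injective
  · exact List.nodup_nil

theorem mem_bagList {t v : ℕ} :
    v ∈ bagList I t ↔ ∃ (ht : t < D.m) (hv : v < H.n), ⟨v, hv⟩ ∈ D.bag ⟨t, ht⟩ := by
  by_cases ht : t < D.m <;> simp [bagList, ht, ← I.mem_bags, Fin.exists_iff]

theorem isParentMap (hm : 0 < D.m) : IsParentMap D.tree ⟨0, hm⟩ I.parent where
  lt t ht := I.parent_lt t (Nat.pos_of_ne_zero (by simpa [Fin.ext_iff] using ht))
  adj t ht := I.parent_adj t (Nat.pos_of_ne_zero (by simpa [Fin.ext_iff] using ht))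

theorem bijOn_getD {l : List ℕ} (hl : l.Nodup) :
    Set.BijOn (fun i => l.getD i 0) (Set.Iio l.toFinset.card) l.toFinset := by
  rw [List.toFinset_card_of_nodup hl]
  refine ⟨fun i hi => ?_, fun i hi j hj hij => ?_, fun v hv => ?_⟩
  · rw [Set.mem_Iio] at hi
    simp [hi]
  · rw [Set.mem_Iio] at hi hj
    simpa [hi, hj, hl.getElem_inj_iff] using hij
  · obtain ⟨i, hi, rfl⟩ := List.getElem_of_mem (List.mem_toFinset.1 hv)
    exact ⟨i, hi, by simp [hi]⟩

theorem exists_bag_of_mem_terms {i j : Fin H.n} (h : (i, j) ∈ H.terms) :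
    ∃ t, i ∈ D.bag t ∧ j ∈ D.bag t := by
  by_cases hij : i = j
  · obtain ⟨⟨t, ht⟩⟩ := (D.connected i).nonempty
    exact ⟨t, ht, hij ▸ ht⟩
  · exact D.covering i j ((SimpleGraph.fromRel_adj _ _ _).2 ⟨hij, .inl h⟩)

/-- The rooted instance which a machine input describes. -/
def rootedInstance : RootedInstance where
  numVars := H.n
  numTerms := I.terms.length
  numNodes := D.m
  left q := if hq : q < I.terms.length then I.terms[q].1 else 0
  right q := if hq : q < I.terms.length then I.terms[q].2 else 0
  weight q := if hq : q < I.terms.length then H.weight I.terms[q].1 I.terms[q].2 else 0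
  parent t := if ht : t < D.m then I.parent ⟨t, ht⟩ else 0
  bag t := (bagList I t).toFinset
  elem t l := (bagList I t).getD l 0
  bijOn_elem t := bijOn_getD (nodup_bagList I t)
  node_lt_of_mem t v hv := ((mem_bagList I).1 (List.mem_toFinset.1 hv)).1
  lt_of_mem t v hv := ((mem_bagList I).1 (List.mem_toFinset.1 hv)).2.1
  exists_mem v hv := by
    obtain ⟨⟨t, ht⟩⟩ := (D.connected ⟨v, hv⟩).nonempty
    exact ⟨t, List.mem_toFinset.2 ((mem_bagList I).2 ⟨t.isLt, hv, ht⟩)⟩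
  parent_lt t h0 := by
    split
    · exact I.parent_lt _ h0
    · exact h0
  mem_parent t u v hut hu hv := by
    simp only [List.mem_toFinset, mem_bagList] at hu hv ⊢
    obtain ⟨hum, hvn, hu⟩ := hu
    obtain ⟨ht, _, hv⟩ := hv
    simp only [ht, dif_pos]
    exact ⟨Fin.isLt _, hvn, (isParentMap I (Nat.zero_lt_of_lt hum)).parent_mem D.isTree
      (D.connected ⟨v, hvn⟩) hu hv hut⟩
  exists_mem_term q hq := by
    obtain ⟨t, hl, hr⟩ :=
      exists_bag_of_mem_terms (D := D) ((I.mem_terms _).1 (I.terms.getElem_mem hq))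
    simp only [List.mem_toFinset, mem_bagList, hq, dif_pos]
    exact ⟨t, ⟨t.isLt, Fin.isLt _, hl⟩, t.isLt, Fin.isLt _, hr⟩

theorem flatMap_range {α : Type*} (n : ℕ) (f : ℕ → List α) :
    (List.range n).flatMap f = (List.finRange n).flatMap fun i : Fin n => f i := by
  rw [← List.map_coe_finRange_eq_range, List.flatMap_map]

theorem bag_rootedInstance (t : Fin D.m) :
    (rootedInstance I).bag t = (D.bag t).map Fin.valEmbedding := by
  ext v
  simp [rootedInstance, mem_bagList, Fin.exists_iff]

theorem card_bag_rootedInstance (t : ℕ) :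
    ((rootedInstance I).bag t).card = (bagList I t).length :=
  List.toFinset_card_of_nodup (nodup_bagList I t)

theorem map_elem_rootedInstance (t : ℕ) :
    (List.range ((rootedInstance I).bag t).card).map ((rootedInstance I).elem t) = bagList I t := by
  rw [card_bag_rootedInstance]
  refine List.ext_getElem (by simp) fun l hl hl' => ?_
  simp [rootedInstance, hl']

theorem encode_rootedInstance : (rootedInstance I).encode = I.encode := by
  have hterms : (List.range I.terms.length).flatMap (fun q => [((rootedInstance I).left q : ℤ),
      ((rootedInstance I).right q : ℤ), (rootedInstance I).weight q]) =
      I.terms.flatMap fun p => [((p.1 : ℕ) : ℤ), ((p.2 : ℕ) : ℤ), H.weight p.1 p.2] := by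
    conv_rhs => rw [← I.terms.map_getElem_finRange, List.flatMap_map]
    rw [flatMap_range]
    simp [rootedInstance]
  have helem (t : Fin D.m) : (List.range ((rootedInstance I).bag t).card).map
      (fun l => ((rootedInstance I).elem t l : ℤ)) = (I.bags t).map fun v => ((v : ℕ) : ℤ) := by
    have h := congrArg (List.map (Nat.cast : ℕ → ℤ)) (map_elem_rootedInstance I t)
    rw [bagList_eq] at h
    simpa [← List.map_eq_flatMap, Function.comp_def] using h
  rw [RootedInstance.encode, Presentation.encode, ← hterms,
    show (rootedInstance I).numNodes = D.m from rfl, flatMap_range D.m]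
  simp only [helem]
  simp only [card_bag_rootedInstance]
  simp [rootedInstance, bagList_eq]

/-- The vector of `{0, 1}ⁿ` given by the first `n` entries of a sequence of truth values. -/
def restrict (n : ℕ) (x : ℕ → Bool) : Fin n → Fin 2 := fun i => if x i then 1 else 0

theorem val_restrict (n : ℕ) (x : ℕ → Bool) (i : Fin n) : (restrict n x i : ℕ) = (x i).toNat := by
  cases h : x i <;> simp [restrict, h]

theorem restrict_surjective (n : ℕ) : Function.Surjective (restrict n) := by
  refine fun y => ⟨fun v => if hv : v < n then y ⟨v, hv⟩ = 1 else false, funext fun i => ?_⟩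
  rcases Fin.exists_fin_two.1 ⟨y i, rfl⟩ with h | h <;> simp [restrict, h]

theorem toFinset_terms [DecidableEq (Fin H.n × Fin H.n)] : I.terms.toFinset = H.terms := by
  ext p
  simp [I.mem_terms]

theorem numTerms_rootedInstance : (rootedInstance I).numTerms = H.terms.card := by
  classical
  rw [← toFinset_terms I, List.toFinset_card_of_nodup I.terms_nodup, rootedInstance]

theorem energy_rootedInstance_eq_sum_terms (x : ℕ → Bool) : (rootedInstance I).energy x =
    ∑ p ∈ H.terms, if x p.1 && x p.2 then H.weight p.1 p.2 else 0 := by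
  rw [← toFinset_terms I, List.sum_toFinset _ I.terms_nodup, ← Fin.sum_univ_fun_getElem]
  refine (Finset.sum_range _).trans (Finset.sum_congr rfl fun q _ => ?_)
  have hq : (q : ℕ) < I.terms.length := q.isLt
  simp [RootedInstance.term, rootedInstance, hq]

theorem sum_terms (f : Fin H.n → Fin H.n → ℤ) (hf : ∀ i j, H.weight i j = 0 → f i j = 0) :
    ∑ p ∈ H.terms, f p.1 p.2 = ∑ i, f i i + ∑ i, ∑ j ∈ Finset.Ioi i, f i j := by
  have hIci : ∑ p ∈ H.terms, f p.1 p.2 = ∑ i, ∑ j ∈ Finset.Ici i, f i j := by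
    rw [Hamiltonian.terms, Finset.sum_filter, Fintype.sum_prod_type]
    refine Finset.sum_congr rfl fun i _ => ?_
    rw [← Finset.filter_le_eq_Ici, Finset.sum_filter]
    refine Finset.sum_congr rfl fun j _ => ?_
    by_cases hw : H.weight i j = 0 <;> simp [hw, hf]
  rw [hIci, ← Finset.sum_add_distrib]
  exact Finset.sum_congr rfl fun i _ => (Finset.add_sum_Ioi_eq_sum_Ici i).symm

theorem energy_restrict (x : ℕ → Bool) :
    H.energy (restrict H.n x) = (rootedInstance I).energy x := by
  rw [energy_rootedInstance_eq_sum_terms,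
    sum_terms (fun i j => if x i && x j then H.weight i j else 0) (by simp +contextual),
    Hamiltonian.energy]
  congr 1
  · refine Finset.sum_congr rfl fun i _ => ?_
    cases h : x i <;> simp [val_restrict, Hamiltonian.weight, h]
  · refine Finset.sum_congr rfl fun i _ => Finset.sum_congr rfl fun j hj => ?_
    have hij : i ≠ j := (Finset.mem_Ioi.1 hj).ne
    cases hi : x i <;> cases hj : x j <;> simp [val_restrict, Hamiltonian.weight, hi, hj, hij]

theorem isGroundState_restrict {x : ℕ → Bool} :
    H.IsGroundState (restrict H.n x) ↔
      ∀ y, (rootedInstance I).energy x ≤ (rootedInstance I).energy y := by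
  simp only [Hamiltonian.IsGroundState, (restrict_surjective H.n).forall, energy_restrict I]

theorem tableSize_rootedInstance_le (t : ℕ) :
    (rootedInstance I).tableSize t ≤ 2 * 2 ^ D.width := by
  rw [← pow_succ', RootedInstance.tableSize]
  refine Nat.pow_le_pow_right (by norm_num) ?_
  by_cases ht : t < D.m
  · have hle : (D.bag ⟨t, ht⟩).card ≤ Finset.univ.sup fun t => (D.bag t).card :=
      Finset.le_sup (f := fun t => (D.bag t).card) (Finset.mem_univ _)
    rw [show (rootedInstance I).bag t = _ from bag_rootedInstance I ⟨t, ht⟩, Finset.card_map,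
      TreeDecomposition.width]
    omega
  · simp [card_bag_rootedInstance, bagList, ht]

theorem solve_presentation : Cmd.Ensures Cmd.solve (Store.initial I.encode)
    (208 * 2 ^ D.width * (H.size + D.m)) fun s =>
      ∃ x, H.IsGroundState x ∧ ∀ i : Fin H.n, s.arr .input i = ((x i : ℕ) : ℤ) := by
  have hm : 0 < D.m := Fin.pos_iff_nonempty.2 D.isTree.connected.nonempty
  have hspec := Cmd.solve_spec (I := rootedInstance I) (B := 2 * 2 ^ D.width)
    (s := Store.initial I.encode) (encode_rootedInstance I ▸ (rootedInstance I).encodes_encode)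
    (fun A hA => funext fun i => if_neg hA) (fun t _ => tableSize_rootedInstance_le I t)
    (Nat.one_le_two_pow.trans (Nat.le_mul_of_pos_left _ two_pos))
  refine hspec.mono ?_ fun s _ ⟨x, hmin, hx⟩ =>
    ⟨restrict H.n x, (isGroundState_restrict I).2 hmin, fun i => ?_⟩
  · rw [numTerms_rootedInstance]
    change 52 * (2 * 2 ^ D.width) * (1 + H.n + H.terms.card + D.m) ≤ _
    calc 52 * (2 * 2 ^ D.width) * (1 + H.n + H.terms.card + D.m)
        ≤ 52 * (2 * 2 ^ D.width) * (2 * (H.n + H.terms.card + D.m)) := by gcongr; omega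
      _ = 208 * 2 ^ D.width * (H.size + D.m) := by rw [Hamiltonian.size]; ring
  · rw [hx i i.isLt, val_restrict]

end Presentation

end QUBO

theorem mainTheorem3 :
    ∃ (P : RAM.Program) (C : ℕ),
      ∀ (H : Hamiltonian) (D : TreeDecomposition H.primalGraph) (I : Presentation H D),
        ∃ (s : RAM.State) (t : ℕ),
          RAM.Runs P (RAM.initial I.encode) s t ∧
          (∃ x : Fin H.n → Fin 2, H.IsGroundState x ∧
            ∀ i : Fin H.n, s.mem ((i : ℕ) : ℤ) = ((x i : ℕ) : ℤ)) ∧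
          t ≤ C * 2 ^ D.width * (H.size + D.m) ∧
          (D.width = H.tw → D.m ≤ H.size → t ≤ C * 2 ^ H.tw * H.size) := by
  obtain ⟨P, κ, hP⟩ := QUBO.Cmd.exists_runs QUBO.Cmd.solve
  refine ⟨P, 416 * κ, fun H D I => ?_⟩
  obtain ⟨s, t, hrun, ht, hmem⟩ := hP I.encode
  obtain ⟨hcost, x, hmin, hx⟩ := QUBO.solve_presentation I
  have hsize : t ≤ 208 * κ * 2 ^ D.width * (H.size + D.m) :=
    (ht.trans (Nat.mul_le_mul_left κ hcost)).trans_eq (by ring)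
  refine ⟨s, t, hrun, ⟨_, hmin, fun i => ?_⟩, ?_, fun htw hm => ?_⟩
  · rw [hmem, hx]
  · exact hsize.trans (by gcongr; norm_num)
  · calc t ≤ 208 * κ * 2 ^ D.width * (H.size + D.m) := hsize
      _ ≤ 208 * κ * 2 ^ D.width * (H.size + H.size) := by gcongr
      _ = 416 * κ * 2 ^ H.tw * H.size := by rw [htw]; ring
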